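/- Let $c<a<b<d$ and let $\gamma:[c,d]\to\mathbb R^2$ be injective, of class $C^1$, with nowhere vanishing derivative, and real-analytic on $[a,b]$ (one-sidedly at $a$ and $b$). Put $\Gamma=\gamma([a,b])$ (a simple analytic arc) and $\tilde\Gamma=\gamma([c,d])$ (an extension of $\Gamma$ with different endpoints), and for $\delta>0$ let $\Gamma_\delta=\{p\in\mathbb R^2:\operatorname{dist}(p,\Gamma)<\delta\}$. For an open set $A\subset\mathbb R^2$ and $\Gamma\subset\partial A$ let $$K(\Gamma,A)=\inf\Big\{\int_A|\nabla v|^2\,dx\,dy:\ v\in H^1(A),\ \int_\Gamma v^2\,d\mathcal H^1=1,\ v=0\ \text{on}\ \partial A\setminus\Gamma\Big\},$$ where the values of $v$ on $\partial A$ are those of its trace: $w\in L^2(\partial A,\mathcal H^1)$ is the trace of $v$ if some sequence $\varphi_n\in C^\infty(\mathbb R^2)$ converges to $v$ in $H^1(A)$ and to $w$ in $L^2(\partial A,\mathcal H^1)$. Then, for all sufficiently small $\delta>0$, the set $\Gamma_\delta\setminus\tilde\Gamma$ has exactly two connected components $\Gamma_\delta^{+}$ and $\Gamma_\delta^{-}$,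 each having $\Gamma$ in its boundary, and the class of admissible $v$ for $K(\Gamma,\Gamma_\delta^{\pm})$ is nonempty, so that $K(\Gamma,\Gamma_\delta^\pm)$ is a real number; moreover $$\lim_{\delta\to0^+}K(\Gamma,\Gamma_\delta^{+})=\lim_{\delta\to0^+}K(\Gamma,\Gamma_\delta^{-})=+\infty,$$ however the two components are labelled for each $\delta$. -/

import Mathlib

open Set Filter Topology MeasureTheory
open scoped ContDiff

/-- The Euclidean plane. -/
abbrev Plane : Type := EuclideanSpace ℝ (Fin 2)

/-- `γ` restricted to `[c, d]` parametrizes a simple regular arc: it is of class `C¹`, injective,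
and its velocity never vanishes. -/
structure IsSimpleRegularArc (γ : ℝ → Plane) (c d : ℝ) : Prop where
  lt : c < d
  contDiffOn : ContDiffOn ℝ 1 γ (Icc c d)
  velocity_ne_zero : ∀ s ∈ Icc c d, derivWithin γ (Icc c d) s ≠ 0
  injOn : InjOn γ (Icc c d)

/-- `γ` restricted to `[a, b]` parametrizes a simple analytic arc. Analyticity on the compact
interval is one-sided at its endpoints. -/
structure IsSimpleAnalyticArc (γ : ℝ → Plane) (a b : ℝ) : Prop extends
    IsSimpleRegularArc γ a b where
  analyticOn : AnalyticOn ℝ γ (Icc a b)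

/-- The set of connected components of a subset `S` of the plane. -/
def componentsOf (S : Set Plane) : Set (Set Plane) :=
  {C | ∃ x ∈ S, C = connectedComponentIn S x}

/-- `g` is the distributional gradient of `v` in the open set `A`. -/
def IsWeakGradient (A : Set Plane) (v : Plane → ℝ) (g : Plane → Plane) : Prop :=
  ∀ φ : Plane → ℝ, ContDiff ℝ ∞ φ → HasCompactSupport φ → tsupport φ ⊆ A → ∀ i : Fin 2,
    ∫ x in A, v x * fderiv ℝ φ x (EuclideanSpace.single i 1) = - ∫ x in A, g x i * φ x

/-- `v` belongs to the Sobolev space `H¹(A)` and `g` is its weak gradient. -/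
structure IsH1With (A : Set Plane) (v : Plane → ℝ) (g : Plane → Plane) : Prop where
  memLp : MemLp v 2 (volume.restrict A)
  memLp_grad : MemLp g 2 (volume.restrict A)
  weakGradient : IsWeakGradient A v g

/-- `w` is the trace on `∂A` of the function `v ∈ H¹(A)` with weak gradient `g`. The trace operator
is the continuous extension, from `H¹(A)` to `L²(∂A, ℋ¹)`, of the restriction to `∂A` of functions
that are smooth up to the boundary. -/
def HasBoundaryTrace (A : Set Plane) (v : Plane → ℝ) (g : Plane → Plane) (w : Plane → ℝ) : Prop :=
  MemLp w 2 ((Measure.hausdorffMeasure 1).restrict (frontier A)) ∧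
  ∃ φ : ℕ → Plane → ℝ, (∀ n, ContDiff ℝ ∞ (φ n)) ∧
    Tendsto (fun n => eLpNorm (fun x => φ n x - v x) 2 (volume.restrict A)) atTop (𝓝 0) ∧
    Tendsto (fun n => eLpNorm (fun x => gradient (φ n) x - g x) 2 (volume.restrict A))
      atTop (𝓝 0) ∧
    Tendsto (fun n => eLpNorm (fun x => φ n x - w x) 2
      ((Measure.hausdorffMeasure 1).restrict (frontier A))) atTop (𝓝 0)

/-- `v ∈ H¹(A)`, with weak gradient `g` and trace `w`, is a competitor in the variational problem
defining `K(Γ, A)`: `∫_Γ v² dℋ¹ = 1` and `v = 0` on `∂A \ Γ`. -/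
structure IsCompetitor (Γ A : Set Plane) (v : Plane → ℝ) (g : Plane → Plane) (w : Plane → ℝ) :
    Prop where
  isH1 : IsH1With A v g
  trace : HasBoundaryTrace A v g w
  normalized : ∫ x in Γ, w x ^ 2 ∂(Measure.hausdorffMeasure 1) = 1
  vanishes : ∀ᵐ x ∂((Measure.hausdorffMeasure 1).restrict (frontier A \ Γ)), w x = 0

/-- The quantity `K(Γ, A)`, the infimum of the Dirichlet integrals of the competitors. It is used
for `Γ ⊆ ∂A`. (As an infimum of real numbers it is `0` when there is no competitor.) -/
noncomputable def capacityK (Γ A : Set Plane) : ℝ :=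
  sInf {e : ℝ | ∃ v g w, IsCompetitor Γ A v g w ∧ e = ∫ x in A, ‖g x‖ ^ 2}

/-! Two facts are combined: a topological one about the sides of the arc, and a one-dimensional
Poincaré inequality across a strip of width δ.

Sides. For small δ a point within δ of Γ and off the extended arc has its nearest point on that arc
at an interior parameter, so it equals γ s + t N s with t ≠ 0. The extension is only C¹ and its
normal merely continuous, so normal coordinates need not be injective there. Each side is therefore
described as a union of truncated cones of half-angle 60° about ±N. Near flatness of the arc makes
the two unions disjoint (`disjoint_sideSet_neg`). A strip is connected because each of its points is
joined by a segment to the normal collar over Γ (`segment_subset_sideSet`, `isConnected_sideStrip`).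

Energy. Over [a, b] the arc is analytic, so the normal is Lipschitz and (s, t) ↦ γ s + t N s is
bi-Lipschitz for small t. The normal segment of length δ from a point of Γ crosses the strip and
ends on the boundary off Γ, where a competitor has zero trace. The fundamental theorem of calculus
and Cauchy–Schwarz on each segment, integrated along Γ, bound ∫_Γ φ² by C(∫_{∂A∖Γ} φ² + δ∫_A |∇φ|²)
for smooth φ. Passing to the limit along the sequence defining the trace gives 1 ≤ Cδ∫_A |g|², hence
K ≥ c/δ.

A bump function centred at the midpoint of Γ shows that competitors exist; without one the infimum
would be 0 by convention. -/

/-- Rotation of the plane by a right angle. -/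
noncomputable def quarterTurn : Plane →ₗᵢ[ℝ] Plane where
  toFun v := !₂[-v 1, v 0]
  map_add' u v := by ext i; fin_cases i <;> simp [add_comm]
  map_smul' r v := by ext i; fin_cases i <;> simp
  norm_map' v := by
    simp [EuclideanSpace.norm_eq, Fin.sum_univ_two, add_comm]

theorem quarterTurn_apply_zero (v : Plane) : quarterTurn v 0 = -v 1 := rfl

theorem quarterTurn_apply_one (v : Plane) : quarterTurn v 1 = v 0 := rfl

theorem plane_inner_eq (u v : Plane) : inner ℝ u v = u 0 * v 0 + u 1 * v 1 := by
  simp [PiLp.inner_apply, Fin.sum_univ_two, mul_comm]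

theorem plane_norm_sq (u : Plane) : ‖u‖ ^ 2 = u 0 ^ 2 + u 1 ^ 2 := by
  rw [← real_inner_self_eq_norm_sq, plane_inner_eq]; ring

theorem inner_quarterTurn_self (v : Plane) : inner ℝ v (quarterTurn v) = 0 := by
  rw [plane_inner_eq, quarterTurn_apply_zero, quarterTurn_apply_one]; ring

/-- A vector orthogonal to the unit vector `u` is a multiple of the rotated vector. -/
theorem eq_smul_quarterTurn {u v : Plane} (hu : ‖u‖ = 1) (h : inner ℝ u v = 0) :
    v = inner ℝ (quarterTurn u) v • quarterTurn u := by
  have h1 : u 0 ^ 2 + u 1 ^ 2 = 1 := by rw [← plane_norm_sq, hu]; norm_num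
  rw [plane_inner_eq] at h
  ext i
  fin_cases i
  · simp only [Fin.zero_eta, PiLp.smul_apply, plane_inner_eq, quarterTurn_apply_zero,
      quarterTurn_apply_one, smul_eq_mul]
    linear_combination (-(v 0)) * h1 + u 0 * h
  · simp only [Fin.mk_one, PiLp.smul_apply, plane_inner_eq, quarterTurn_apply_zero,
      quarterTurn_apply_one, smul_eq_mul]
    linear_combination (-(v 1)) * h1 + u 1 * h

/-! ### Moving frame of the arc and uniform near-straightness -/

/-- The velocity of `γ` along `[c, d]`. -/
noncomputable def velocity (γ : ℝ → Plane) (c d s : ℝ) : Plane := derivWithin γ (Icc c d) s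

/-- The unit tangent vector of `γ` along `[c, d]`. -/
noncomputable def unitTangent (γ : ℝ → Plane) (c d s : ℝ) : Plane :=
  ‖velocity γ c d s‖⁻¹ • velocity γ c d s

/-- The unit normal vector of `γ` along `[c, d]`. -/
noncomputable def unitNormal (γ : ℝ → Plane) (c d s : ℝ) : Plane :=
  quarterTurn (unitTangent γ c d s)

/-- A pair of orthonormal vector fields along the arc `γ` that is tangent, resp. normal, to the arc
up to small relative errors at distances less than `ρ`. -/
structure IsTransverseFrame (γ T N : ℝ → Plane) (c d ρ : ℝ) : Prop where
  pos : 0 < ρ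
  continuousOn : ContinuousOn γ (Icc c d)
  norm_tangent : ∀ s ∈ Icc c d, ‖T s‖ = 1
  norm_normal : ∀ s ∈ Icc c d, ‖N s‖ = 1
  orthogonal : ∀ s ∈ Icc c d, inner ℝ (T s) (N s) = 0
  continuousOn_normal : ContinuousOn N (Icc c d)
  normal_close : ∀ s ∈ Icc c d, ∀ s' ∈ Icc c d, ‖γ s - γ s'‖ < ρ → ∀ r ∈ uIcc s s',
    ‖N s - N r‖ ≤ 1 / 4
  flat : ∀ s ∈ Icc c d, ∀ s' ∈ Icc c d, ‖γ s - γ s'‖ < ρ →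
    |inner ℝ (N s) (γ s - γ s')| ≤ 1 / 4 * ‖γ s - γ s'‖
  chord : ∀ s ∈ Icc c d, ∀ s' ∈ Icc c d, ‖γ s - γ s'‖ < ρ → ∀ l ∈ Icc (0 : ℝ) 1,
    ‖(1 - l) • γ s + l • γ s' - γ ((1 - l) * s + l * s')‖ ≤
      l / 25 * |inner ℝ (T s) (γ s - γ s')|

theorem IsTransverseFrame.neg {γ T N : ℝ → Plane} {c d ρ : ℝ}
    (h : IsTransverseFrame γ T N c d ρ) : IsTransverseFrame γ T (-N) c d ρ where
  pos := h.pos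
  continuousOn := h.continuousOn
  norm_tangent := h.norm_tangent
  norm_normal s hs := by simpa using h.norm_normal s hs
  orthogonal s hs := by simpa using h.orthogonal s hs
  continuousOn_normal := h.continuousOn_normal.neg
  normal_close s hs s' hs' hss r hr := by
    have := h.normal_close s hs s' hs' hss r hr
    rwa [Pi.neg_apply, Pi.neg_apply, ← neg_sub', norm_neg]
  flat s hs s' hs' hss := by simpa using h.flat s hs s' hs' hss
  chord := h.chord

namespace IsSimpleRegularArc

variable {γ : ℝ → Plane} {c d : ℝ}

theorem hasDerivWithinAt (h : IsSimpleRegularArc γ c d) {s : ℝ} (hs : s ∈ Icc c d) :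
    HasDerivWithinAt γ (velocity γ c d s) (Icc c d) s :=
  (h.contDiffOn.differentiableOn one_ne_zero s hs).hasDerivWithinAt

theorem continuousOn_velocity (h : IsSimpleRegularArc γ c d) :
    ContinuousOn (velocity γ c d) (Icc c d) :=
  h.contDiffOn.continuousOn_derivWithin (uniqueDiffOn_Icc h.lt) le_rfl

theorem norm_velocity_pos (h : IsSimpleRegularArc γ c d) {s : ℝ} (hs : s ∈ Icc c d) :
    0 < ‖velocity γ c d s‖ :=
  norm_pos_iff.2 (h.velocity_ne_zero s hs)

theorem exists_le_norm_velocity (h : IsSimpleRegularArc γ c d) :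
    ∃ m > 0, ∀ s ∈ Icc c d, m ≤ ‖velocity γ c d s‖ := by
  obtain ⟨s, hs, hmin⟩ := isCompact_Icc.exists_isMinOn (nonempty_Icc.2 h.lt.le)
    h.continuousOn_velocity.norm
  exact ⟨_, h.norm_velocity_pos hs, fun r hr => hmin hr⟩

theorem norm_unitTangent (h : IsSimpleRegularArc γ c d) {s : ℝ} (hs : s ∈ Icc c d) :
    ‖unitTangent γ c d s‖ = 1 := by
  rw [unitTangent, norm_smul, norm_inv, norm_norm,
    inv_mul_cancel₀ (h.norm_velocity_pos hs).ne']

theorem norm_unitNormal (h : IsSimpleRegularArc γ c d) {s : ℝ} (hs : s ∈ Icc c d) :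
    ‖unitNormal γ c d s‖ = 1 := by
  rw [unitNormal, LinearIsometry.norm_map, h.norm_unitTangent hs]

theorem continuousOn_unitNormal (h : IsSimpleRegularArc γ c d) :
    ContinuousOn (unitNormal γ c d) (Icc c d) :=
  quarterTurn.continuous.comp_continuousOn
    ((h.continuousOn_velocity.norm.inv₀ fun _ hs => (h.norm_velocity_pos hs).ne').smul
      h.continuousOn_velocity)

theorem velocity_eq (h : IsSimpleRegularArc γ c d) {s : ℝ} (hs : s ∈ Icc c d) :
    velocity γ c d s = ‖velocity γ c d s‖ • unitTangent γ c d s := by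
  rw [unitTangent, smul_smul, mul_inv_cancel₀ (h.norm_velocity_pos hs).ne', one_smul]

theorem inner_unitNormal_velocity (h : IsSimpleRegularArc γ c d) {s : ℝ} (hs : s ∈ Icc c d) :
    inner ℝ (unitNormal γ c d s) (velocity γ c d s) = 0 := by
  rw [h.velocity_eq hs, inner_smul_right, real_inner_comm, unitNormal, inner_quarterTurn_self,
    mul_zero]

/-- Mean value inequality for r ↦ γ r - r u. It serves twice: with ε from uniform continuity of the
velocity, and with ε proportional to |s - s'| when the velocity is Lipschitz. -/
theorem norm_sub_sub_smul_le (h : IsSimpleRegularArc γ c d) {s s' : ℝ} (hs : s ∈ Icc c d)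
    (hs' : s' ∈ Icc c d) {u : Plane} {ε : ℝ}
    (hu : ∀ r ∈ uIcc s s', ‖velocity γ c d r - u‖ ≤ ε) :
    ‖γ s' - γ s - (s' - s) • u‖ ≤ ε * |s' - s| := by
  have hsub : uIcc s s' ⊆ Icc c d := by
    rw [← uIcc_of_le h.lt.le] at hs hs' ⊢; exact uIcc_subset_uIcc hs hs'
  have := (convex_uIcc s s').norm_image_sub_le_of_norm_hasDerivWithin_le (𝕜 := ℝ)
    (f := fun r => γ r - r • u) (f' := fun r => velocity γ c d r - u) (C := ε)
    (fun r hr => by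
      simpa using ((h.hasDerivWithinAt (hsub hr)).mono hsub).fun_sub
        ((hasDerivWithinAt_id r (uIcc s s')).smul_const u)) hu left_mem_uIcc right_mem_uIcc
  have e : γ s' - γ s - (s' - s) • u = γ s' - s' • u - (γ s - s • u) := by module
  rwa [e, ← Real.norm_eq_abs]

/-- Pairs of parameters at least η apart form a compact set, on which injectivity gives the chord
length a positive minimum. -/
theorem exists_dist_lt (h : IsSimpleRegularArc γ c d) {η : ℝ} (hη : 0 < η) :
    ∃ ρ > 0, ∀ s ∈ Icc c d, ∀ s' ∈ Icc c d, ‖γ s - γ s'‖ < ρ → |s - s'| < η := by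
  set K : Set (ℝ × ℝ) := (Icc c d ×ˢ Icc c d) ∩ {p | η ≤ |p.1 - p.2|} with hK
  have hKc : IsCompact K := (isCompact_Icc.prod isCompact_Icc).inter_right
    (isClosed_le continuous_const (by fun_prop))
  have hcont : ContinuousOn (fun p : ℝ × ℝ => ‖γ p.1 - γ p.2‖) K :=
    ((h.contDiffOn.continuousOn.comp continuousOn_fst fun p hp => hp.1.1).sub
      (h.contDiffOn.continuousOn.comp continuousOn_snd fun p hp => hp.1.2)).norm
  rcases K.eq_empty_or_nonempty with hE | hne
  · refine ⟨1, one_pos, fun s hs s' hs' _ => ?_⟩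
    by_contra! hcon
    exact hE.subset (show (s, s') ∈ K from ⟨⟨hs, hs'⟩, hcon⟩)
  · obtain ⟨p, hp, hmin⟩ := hKc.exists_isMinOn hne hcont
    refine ⟨‖γ p.1 - γ p.2‖, ?_, fun s hs s' hs' hlt => ?_⟩
    · rw [gt_iff_lt, norm_pos_iff, sub_ne_zero]
      intro heq
      have := h.injOn hp.1.1 hp.1.2 heq
      have h2 : η ≤ |p.1 - p.2| := hp.2
      simp [this] at h2
      linarith
    · by_contra! hcon
      exact (hmin (show (s, s') ∈ K from ⟨⟨hs, hs'⟩, hcon⟩)).not_gt hlt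

/-- At small distances the arc is nearly straight. -/
theorem exists_norm_sub_sub_smul_le (h : IsSimpleRegularArc γ c d) {ε : ℝ} (hε : 0 < ε) :
    ∃ ρ > 0, ∀ s ∈ Icc c d, ∀ s' ∈ Icc c d, ‖γ s - γ s'‖ < ρ → ∀ r ∈ uIcc s s',
      ‖unitNormal γ c d s - unitNormal γ c d r‖ ≤ ε ∧
      ‖γ r - γ s - (r - s) • velocity γ c d s‖ ≤ ε * |r - s| := by
  have h1 := Metric.uniformContinuousOn_iff.1
    (isCompact_Icc.uniformContinuousOn_of_continuous h.continuousOn_velocity) ε hε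
  have h2 := Metric.uniformContinuousOn_iff.1
    (isCompact_Icc.uniformContinuousOn_of_continuous h.continuousOn_unitNormal) ε hε
  obtain ⟨η₁, hη₁, h1⟩ := h1
  obtain ⟨η₂, hη₂, h2⟩ := h2
  obtain ⟨ρ, hρ, h3⟩ := h.exists_dist_lt (lt_min hη₁ hη₂)
  refine ⟨ρ, hρ, fun s hs s' hs' hlt r hr => ?_⟩
  have hsub : uIcc s s' ⊆ Icc c d := by
    rw [← uIcc_of_le h.lt.le] at hs hs' ⊢; exact uIcc_subset_uIcc hs hs'
  have key : ∀ q ∈ uIcc s s', |q - s| < min η₁ η₂ := fun q hq =>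
    (abs_sub_left_of_mem_uIcc hq).trans_lt (by rw [abs_sub_comm]; exact h3 s hs s' hs' hlt)
  constructor
  · rw [← dist_eq_norm, dist_comm]
    exact (h2 r (hsub hr) s hs ((key r hr).trans_le (min_le_right _ _))).le
  · refine h.norm_sub_sub_smul_le hs (hsub hr) fun q hq => ?_
    have hq' := uIcc_subset_uIcc left_mem_uIcc hr hq
    rw [← dist_eq_norm]
    exact (h1 q (hsub hq') s hs ((key q hq').trans_le (min_le_left _ _))).le

theorem exists_isTransverseFrame (h : IsSimpleRegularArc γ c d) :
    ∃ ρ, IsTransverseFrame γ (unitTangent γ c d) (unitNormal γ c d) c d ρ := by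
  obtain ⟨m, hm, hmle⟩ := h.exists_le_norm_velocity
  -- The speed is at least m, so the tangential part of a chord is at least (m - ε)|s' - s|, while
  -- the chord errs from the arc by at most 2εl|s' - s|. Any ε ≤ m/51 yields the factor 1/25; the
  -- cap 1/4 is for the variation of the normal.
  set ε := min (m / 100) (1 / 4) with hεdef
  have hε : 0 < ε := lt_min (by positivity) (by norm_num)
  have hεm : ε ≤ m / 100 := min_le_left _ _
  obtain ⟨ρ, hρ, H⟩ := h.exists_norm_sub_sub_smul_le hε
  refine ⟨ρ, hρ, h.contDiffOn.continuousOn, fun s hs => h.norm_unitTangent hs,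
    fun s hs => h.norm_unitNormal hs, fun s _ => inner_quarterTurn_self _,
    h.continuousOn_unitNormal, fun s hs s' hs' hlt r hr =>
      ((H s hs s' hs' hlt r hr).1).trans (min_le_right _ _), ?_, ?_⟩
  · intro s hs s' hs' hlt
    have h1 := (H s hs s' hs' hlt s' right_mem_uIcc).2
    have h2 : inner ℝ (unitNormal γ c d s) (γ s - γ s') =
        -inner ℝ (unitNormal γ c d s) (γ s' - γ s - (s' - s) • velocity γ c d s) := by
      rw [inner_sub_right _ (γ s' - γ s), inner_smul_right, h.inner_unitNormal_velocity hs,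
        ← neg_sub (γ s'), inner_neg_right]; ring
    rw [h2, abs_neg]
    refine (abs_real_inner_le_norm _ _).trans ?_
    rw [h.norm_unitNormal hs, one_mul]
    refine h1.trans ?_
    have h3 : |s' - s| * m ≤ ε * |s' - s| + ‖γ s - γ s'‖ := by
      calc |s' - s| * m ≤ ‖(s' - s) • velocity γ c d s‖ := by
            rw [norm_smul, Real.norm_eq_abs]; gcongr; exact hmle s hs
        _ = ‖-(γ s' - γ s - (s' - s) • velocity γ c d s) - (γ s - γ s')‖ := by
            congr 1; module
        _ ≤ _ := (norm_sub_le _ _).trans (by rw [norm_neg]; gcongr)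
    have h4 := abs_nonneg (s' - s)
    nlinarith
  · intro s hs s' hs' hlt l hl
    set e₁ := γ s' - γ s - (s' - s) • velocity γ c d s with he₁
    set r := (1 - l) * s + l * s' with hr
    set e₂ := γ r - γ s - (r - s) • velocity γ c d s with he₂
    have hrs : r - s = l * (s' - s) := by rw [hr]; ring
    have hrm : r ∈ uIcc s s' := by
      rw [← segment_eq_uIcc]
      exact ⟨1 - l, l, by linarith [hl.2], hl.1, by ring, by simp [hr]⟩
    have h1 : ‖e₁‖ ≤ _ := (H s hs s' hs' hlt s' right_mem_uIcc).2
    have h2 : ‖e₂‖ ≤ _ := (H s hs s' hs' hlt r hrm).2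
    have h3 : (1 - l) • γ s + l • γ s' - γ r = l • e₁ - e₂ := by
      rw [he₁, he₂, hrs]; module
    rw [hrs, abs_mul, abs_of_nonneg hl.1] at h2
    have h4 : |s' - s| * m - ε * |s' - s| ≤
        |inner ℝ (unitTangent γ c d s) (γ s - γ s')| := by
      have h5 : inner ℝ (unitTangent γ c d s) (γ s - γ s') =
          -((s' - s) * ‖velocity γ c d s‖) - inner ℝ (unitTangent γ c d s) e₁ := by
        have h6 : inner ℝ (unitTangent γ c d s) (velocity γ c d s) = ‖velocity γ c d s‖ := by
          rw [h.velocity_eq hs, inner_smul_right, real_inner_self_eq_norm_sq,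
            h.norm_unitTangent hs, ← h.velocity_eq hs]; ring
        rw [he₁, inner_sub_right _ (γ s' - γ s), inner_smul_right, h6,
          ← neg_sub (γ s'), inner_neg_right]; ring
      have h7 : |inner ℝ (unitTangent γ c d s) e₁| ≤ ε * |s' - s| := by
        refine (abs_real_inner_le_norm _ _).trans ?_
        rwa [h.norm_unitTangent hs, one_mul]
      have h8 : |s' - s| * m ≤ |(s' - s) * ‖velocity γ c d s‖| := by
        rw [abs_mul, abs_norm]; gcongr; exact hmle s hs
      have h9 := abs_sub_abs_le_abs_sub (-((s' - s) * ‖velocity γ c d s‖))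
        (inner ℝ (unitTangent γ c d s) e₁)
      rw [abs_neg] at h9
      rw [h5]; linarith
    rw [h3]
    calc ‖l • e₁ - e₂‖ ≤ l * (ε * |s' - s|) + ε * (l * |s' - s|) := by
          refine (norm_sub_le _ _).trans ?_
          rw [norm_smul, Real.norm_eq_abs, abs_of_nonneg hl.1]
          have := hl.1
          gcongr
      _ = l * (2 * ε * |s' - s|) := by ring
      _ ≤ l * (1 / 25 * |inner ℝ (unitTangent γ c d s) (γ s - γ s')|) := by
          have := abs_nonneg (s' - s)
          refine mul_le_mul_of_nonneg_left ?_ hl.1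
          nlinarith
      _ = _ := by ring

end IsSimpleRegularArc

/-! ### The two sides as unions of cones -/

/-- The union of truncated open cones with vertices on the arc and axes along `N`. -/
def sideSet (γ N : ℝ → Plane) (c d ρ : ℝ) : Set Plane :=
  {p | ∃ s ∈ Icc c d, ‖p - γ s‖ < ρ ∧ ‖p - γ s‖ < 2 * inner ℝ (N s) (p - γ s)}

theorem isOpen_sideSet (γ N : ℝ → Plane) (c d ρ : ℝ) : IsOpen (sideSet γ N c d ρ) := by
  have : sideSet γ N c d ρ = ⋃ s ∈ Icc c d,
      {p | ‖p - γ s‖ < ρ} ∩ {p | ‖p - γ s‖ < 2 * inner ℝ (N s) (p - γ s)} := by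
    ext p; simp [sideSet, and_left_comm]
  rw [this]
  refine isOpen_biUnion fun s _ => (isOpen_lt (by fun_prop) (by fun_prop)).inter
    (isOpen_lt (by fun_prop) (by fun_prop))

namespace IsTransverseFrame

variable {γ T N : ℝ → Plane} {c d ρ : ℝ}

/-- With v, v' the vectors from the two vertices to a common point, adding the cone inequalities
gives ‖v‖ + ‖v'‖ < 2⟨N s, v - v'⟩ + 2⟨N s - N s', v'⟩ ≤ ‖v - v'‖/2 + ‖v'‖/2 ≤ ‖v‖/2 + ‖v'‖, which is
absurd. The radius ρ/2 keeps the vertices within ρ of each other. -/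
theorem disjoint_sideSet_neg (h : IsTransverseFrame γ T N c d ρ) :
    Disjoint (sideSet γ N c d (ρ / 2)) (sideSet γ (-N) c d (ρ / 2)) := by
  rw [Set.disjoint_left]
  rintro p ⟨s, hs, hp, hp2⟩ ⟨s', hs', hq, hq2⟩
  set v := p - γ s with hv
  set v' := p - γ s' with hv'
  have hvv : γ s - γ s' = v' - v := by rw [hv, hv']; abel
  have hlt : ‖γ s - γ s'‖ < ρ := by
    rw [hvv]; exact (norm_sub_le _ _).trans_lt (by linarith)
  have h1 := h.normal_close s hs s' hs' hlt s' right_mem_uIcc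
  have h2 := h.flat s hs s' hs' hlt
  have h3 : |inner ℝ (N s - N s') v'| ≤ 1 / 4 * ‖v'‖ :=
    (abs_real_inner_le_norm _ _).trans (by gcongr)
  rw [inner_sub_left] at h3
  rw [hvv, inner_sub_right] at h2
  rw [Pi.neg_apply, inner_neg_left] at hq2
  have h4 := norm_sub_le v' v
  have h5 := abs_le.1 h2
  have h6 := abs_le.1 h3
  have := norm_nonneg v
  have := norm_nonneg v'
  linarith [h5.1, h6.2]

theorem notMem_sideSet (h : IsTransverseFrame γ T N c d ρ) {s : ℝ} (hs : s ∈ Icc c d) :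
    γ s ∉ sideSet γ N c d (ρ / 2) := by
  rintro ⟨s', hs', hp, hp2⟩
  have hpos := h.pos
  have h1 := h.flat s' hs' s hs (by rw [norm_sub_rev]; linarith)
  rw [norm_sub_rev, ← neg_sub (γ s), inner_neg_right, abs_neg] at h1
  linarith [(abs_le.1 h1).2, norm_nonneg (γ s - γ s')]

theorem add_smul_mem_sideSet (h : IsTransverseFrame γ T N c d ρ) {s t : ℝ} (hs : s ∈ Icc c d)
    (ht : 0 < t) (htρ : t < ρ / 2) : γ s + t • N s ∈ sideSet γ N c d (ρ / 2) := by
  refine ⟨s, hs, ?_, ?_⟩ <;>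
    simp only [add_sub_cancel_left, norm_smul, h.norm_normal s hs, Real.norm_eq_abs,
      abs_of_pos ht, inner_smul_right, real_inner_self_eq_norm_sq] <;> linarith

/-- The point at ratio l of the segment lies in the cone at the interpolated parameter q. Its
displacement from γ q is a combination of N s and N s', both close to N q, of total weight (1 - l)t
+ lr, plus the chord error. As t may be far smaller than r, that error must vanish with l: lr/25 is
absorbed because the weight is at least lr. -/
theorem segment_subset_sideSet (h : IsTransverseFrame γ T N c d ρ) {s s' t r : ℝ}
    (hs : s ∈ Icc c d) (hs' : s' ∈ Icc c d) (ht : 0 < t) (htr : t ≤ r)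
    (hr : ‖γ s + t • N s - γ s'‖ = r) (hrρ : r < ρ / 4) :
    segment ℝ (γ s + t • N s) (γ s' + r • N s') ⊆ sideSet γ N c d (ρ / 2) := by
  intro x hx
  rw [segment_eq_image] at hx
  obtain ⟨l, hl, rfl⟩ := hx
  have hlt : ‖γ s - γ s'‖ < ρ := by
    calc ‖γ s - γ s'‖ = ‖γ s + t • N s - γ s' - t • N s‖ := by congr 1; abel
      _ ≤ r + t := (norm_sub_le _ _).trans (by
        rw [hr, norm_smul, h.norm_normal s hs, Real.norm_eq_abs, abs_of_pos ht, mul_one])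
      _ < ρ := by linarith
  set q := (1 - l) * s + l * s' with hq
  have hqm : q ∈ uIcc s s' := by
    rw [← segment_eq_uIcc]
    exact ⟨1 - l, l, by linarith [hl.2], hl.1, by ring, by simp [hq]⟩
  have hqI : q ∈ Icc c d :=
    (convex_Icc c d) hs hs' (sub_nonneg.2 hl.2) hl.1 (by ring)
  set e := (1 - l) • γ s + l • γ s' - γ q with he
  -- Adding t N s leaves the tangential component unchanged, so it is bounded by r.
  have h1 : |inner ℝ (T s) (γ s - γ s')| ≤ r := by
    have : inner ℝ (T s) (γ s - γ s') = inner ℝ (T s) (γ s + t • N s - γ s') := by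
      have : γ s + t • N s - γ s' = (γ s - γ s') + t • N s := by abel
      rw [this, inner_add_right (T s) (γ s - γ s'), inner_smul_right, h.orthogonal s hs]; ring
    rw [this]
    refine (abs_real_inner_le_norm _ _).trans ?_
    rw [h.norm_tangent s hs, hr, one_mul]
  have h2 : ‖e‖ ≤ l / 25 * r :=
    (h.chord s hs s' hs' hlt l hl).trans (by have := hl.1; gcongr)
  have h3 : ∀ u ∈ Icc c d, ‖N u - N q‖ ≤ 1 / 4 → 3 / 4 ≤ inner ℝ (N q) (N u) := by
    intro u hu hle
    have h5 : |inner ℝ (N u - N q) (N u)| ≤ 1 / 4 :=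
      (abs_real_inner_le_norm _ _).trans (by rw [h.norm_normal u hu, mul_one]; exact hle)
    rw [inner_sub_left, real_inner_self_eq_norm_sq, h.norm_normal u hu] at h5
    linarith [(abs_le.1 h5).2]
  have h4 := h3 s hs (h.normal_close s hs s' hs' hlt q hqm)
  have h5 := h3 s' hs' (h.normal_close s' hs' s hs (by rwa [norm_sub_rev]) q
    (by rwa [uIcc_comm]))
  have hx : (1 - l) • (γ s + t • N s) + l • (γ s' + r • N s') - γ q =
      ((1 - l) * t) • N s + (l * r) • N s' + e := by rw [he]; module
  have hA : 0 ≤ (1 - l) * t := mul_nonneg (sub_nonneg.2 hl.2) ht.le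
  have hr0 : 0 < r := ht.trans_le htr
  have hB : 0 ≤ l * r := mul_nonneg hl.1 hr0.le
  have hW : 0 < (1 - l) * t + l * r := by
    rcases hl.1.eq_or_lt with h0 | h0
    · rw [← h0]; linarith
    · have := mul_pos h0 hr0; linarith
  have hWr : (1 - l) * t + l * r ≤ r := by nlinarith [hl.1, hl.2]
  have hn : ‖((1 - l) * t) • N s + (l * r) • N s' + e‖ ≤
      (1 - l) * t + l * r + l / 25 * r := by
    refine (norm_add₃_le).trans ?_
    rw [norm_smul, norm_smul, h.norm_normal s hs, h.norm_normal s' hs', Real.norm_eq_abs,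
      Real.norm_eq_abs, abs_of_nonneg hA, abs_of_nonneg hB]
    linarith
  have hin : 3 / 4 * ((1 - l) * t + l * r) - l / 25 * r ≤
      inner ℝ (N q) (((1 - l) * t) • N s + (l * r) • N s' + e) := by
    have h6 : |inner ℝ (N q) e| ≤ l / 25 * r :=
      (abs_real_inner_le_norm _ _).trans (by rw [h.norm_normal q hqI, one_mul]; exact h2)
    rw [inner_add_right, inner_add_right, inner_smul_right, inner_smul_right]
    nlinarith [(abs_le.1 h6).1]
  refine ⟨q, hqI, ?_, ?_⟩
  · rw [hx]; linarith
  · rw [hx]; linarith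

end IsTransverseFrame

/-! ### Foot points and connected components -/

/-- Every point off a regular arc and closer to its interior than to its endpoints lies on a
normal line of the arc at its nearest point. -/
theorem IsSimpleRegularArc.exists_eq_add_smul_unitNormal {γ : ℝ → Plane} {a b c d δ : ℝ}
    (h : IsSimpleRegularArc γ c d) (hab : Icc a b ⊆ Icc c d)
    (hδ : ∀ s ∈ Icc a b, ∀ s' ∈ Icc c d, ‖γ s - γ s'‖ < 2 * δ → s' ∈ Ioo c d)
    {p : Plane} (hp : p ∈ Metric.thickening δ (γ '' Icc a b)) (hp' : p ∉ γ '' Icc c d) :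
    ∃ s ∈ Icc c d, ∃ t : ℝ, t ≠ 0 ∧ |t| < δ ∧ p = γ s + t • unitNormal γ c d s ∧
      ∀ s' ∈ Icc c d, |t| ≤ ‖p - γ s'‖ := by
  obtain ⟨s, hs, hmin⟩ := isCompact_Icc.exists_isMinOn (nonempty_Icc.2 h.lt.le)
    (continuousOn_const.sub h.contDiffOn.continuousOn).norm (f := fun s => ‖p - γ s‖)
  rw [Metric.mem_thickening_iff] at hp
  obtain ⟨_, ⟨s₁, hs₁, rfl⟩, hlt⟩ := hp
  rw [dist_eq_norm] at hlt
  have hsδ : ‖p - γ s‖ < δ := (hmin (hab hs₁)).trans_lt hlt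
  -- The minimum is attained away from the endpoints, so the first-order condition is an equality.
  have hsI : s ∈ Ioo c d := by
    refine hδ s₁ hs₁ s hs ?_
    calc ‖γ s₁ - γ s‖ = ‖(p - γ s) - (p - γ s₁)‖ := by congr 1; abel
      _ ≤ _ := norm_sub_le _ _
      _ < _ := by linarith
  have hnhds : Icc c d ∈ 𝓝 s := Icc_mem_nhds hsI.1 hsI.2
  have hder : HasDerivAt (fun r => ‖p - γ r‖ ^ 2)
      (2 * inner ℝ (p - γ s) (-velocity γ c d s)) s :=
    (((h.hasDerivWithinAt hs).hasDerivAt hnhds).const_sub p).norm_sq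
  have hloc : IsLocalMin (fun r => ‖p - γ r‖ ^ 2) s := by
    filter_upwards [hnhds] with r hr
    have : ‖p - γ s‖ ≤ ‖p - γ r‖ := hmin hr
    gcongr
  have h0 := hloc.hasDerivAt_eq_zero hder
  rw [inner_neg_right, real_inner_comm] at h0
  have horth : inner ℝ (unitTangent γ c d s) (p - γ s) = 0 := by
    rw [unitTangent, inner_smul_left]
    simp only [map_inv₀, conj_trivial]
    rw [show inner ℝ (velocity γ c d s) (p - γ s) = 0 by linarith, mul_zero]
  have hfoot := eq_smul_quarterTurn (h.norm_unitTangent hs) horth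
  set t := inner ℝ (quarterTurn (unitTangent γ c d s)) (p - γ s) with ht
  have hnt : ‖p - γ s‖ = |t| := by
    rw [hfoot, norm_smul, LinearIsometry.norm_map, h.norm_unitTangent hs, mul_one,
      Real.norm_eq_abs]
  refine ⟨s, hs, t, ?_, hnt ▸ hsδ, ?_, fun s' hs' => hnt ▸ hmin hs'⟩
  · intro h00
    rw [h00, abs_zero, norm_eq_zero, sub_eq_zero] at hnt
    exact hp' ⟨s, hs, hnt.symm⟩
  · rw [unitNormal, ← hfoot]; abel

theorem componentsOf_eq_pair {S V W : Set Plane} (hS : S = V ∪ W) (hV : IsOpen V) (hW : IsOpen W)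
    (hd : Disjoint V W) (hVc : IsConnected V) (hWc : IsConnected W) :
    componentsOf S = {V, W} := by
  have key : ∀ V W : Set Plane, IsOpen V → IsOpen W → Disjoint V W → IsPreconnected V →
      ∀ x ∈ V, connectedComponentIn (V ∪ W) x = V := by
    intro V W hV hW hd hVc x hx
    refine Subset.antisymm ?_ (hVc.subset_connectedComponentIn hx subset_union_left)
    exact isPreconnected_connectedComponentIn.subset_left_of_subset_union hV hW hd
      (connectedComponentIn_subset _ _) ⟨x, mem_connectedComponentIn (.inl hx), hx⟩
  subst hS
  have k1 := key V W hV hW hd hVc.isPreconnected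
  have k2 := key W V hW hV hd.symm hWc.isPreconnected
  ext C
  constructor
  · rintro ⟨x, hx | hx, rfl⟩
    · exact .inl (k1 x hx)
    · rw [union_comm]; exact .inr (k2 x hx)
  · rintro (rfl | rfl)
    · obtain ⟨x, hx⟩ := hVc.nonempty
      exact ⟨x, .inl hx, (k1 x hx).symm⟩
    · obtain ⟨x, hx⟩ := hWc.nonempty
      exact ⟨x, .inr hx, by rw [union_comm, k2 x hx]⟩

/-! ### Strips: connectedness and boundary -/

/-- The part of the `δ`-neighbourhood of the arc lying on the side of `N`. -/
def sideStrip (γ N : ℝ → Plane) (a b c d ρ δ : ℝ) : Set Plane :=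
  Metric.thickening δ (γ '' Icc a b) ∩ sideSet γ N c d (ρ / 2)

theorem isOpen_sideStrip (γ N : ℝ → Plane) (a b c d ρ δ : ℝ) :
    IsOpen (sideStrip γ N a b c d ρ δ) :=
  Metric.isOpen_thickening.inter (isOpen_sideSet _ _ _ _ _)

namespace IsTransverseFrame

variable {γ T N : ℝ → Plane} {a b c d ρ δ : ℝ}

theorem disjoint_sideStrip (h : IsTransverseFrame γ T N c d ρ) :
    Disjoint (sideStrip γ N a b c d ρ δ) (sideStrip γ (-N) a b c d ρ δ) :=
  h.disjoint_sideSet_neg.mono inter_subset_right inter_subset_right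

theorem add_smul_mem_sideStrip (h : IsTransverseFrame γ T N c d ρ) (hab : Icc a b ⊆ Icc c d)
    (hδ : δ < ρ / 4) {s t : ℝ} (hs : s ∈ Icc a b) (ht : t ∈ Ioo 0 δ) :
    γ s + t • N s ∈ sideStrip γ N a b c d ρ δ := by
  have := h.pos
  refine ⟨?_, h.add_smul_mem_sideSet (hab hs) ht.1 (by linarith [ht.2])⟩
  rw [Metric.mem_thickening_iff]
  refine ⟨γ s, mem_image_of_mem _ hs, ?_⟩
  rw [dist_eq_norm, add_sub_cancel_left, norm_smul, h.norm_normal s (hab hs), mul_one,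
    Real.norm_eq_abs, abs_of_pos ht.1]
  exact ht.2

/-- The collar over [a, b] is the continuous image of a rectangle. A point of the strip may have its
foot outside [a, b], beyond the ends of Γ; it is linked to the collar by a segment. -/
theorem isConnected_sideStrip (h : IsTransverseFrame γ T N c d ρ) (hab : Icc a b ⊆ Icc c d)
    (hlt : a < b) (hδ0 : 0 < δ) (hδ : δ < ρ / 4)
    (hfoot : ∀ p ∈ sideStrip γ N a b c d ρ δ, ∃ s ∈ Icc c d, ∃ t : ℝ, 0 < t ∧
      p = γ s + t • N s ∧ ∀ s' ∈ Icc c d, t ≤ ‖p - γ s'‖) :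
    IsConnected (sideStrip γ N a b c d ρ δ) := by
  set S := (fun q : ℝ × ℝ => γ q.1 + q.2 • N q.1) '' (Icc a b ×ˢ Ioo 0 δ) with hS
  have hSV : S ⊆ sideStrip γ N a b c d ρ δ := by
    rintro _ ⟨q, hq, rfl⟩
    exact h.add_smul_mem_sideStrip hab hδ hq.1 hq.2
  have hSc : IsPreconnected S := by
    refine (isPreconnected_Icc.prod isPreconnected_Ioo).image _ ?_
    exact (h.continuousOn.comp continuousOn_fst fun q hq => hab hq.1).add
      (continuousOn_snd.smul (h.continuousOn_normal.comp continuousOn_fst fun q hq => hab hq.1))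
  have hx₀ : γ a + (δ / 2) • N a ∈ S :=
    ⟨(a, δ / 2), ⟨left_mem_Icc.2 hlt.le, by constructor <;> simp <;> linarith⟩, rfl⟩
  refine ⟨⟨_, hSV hx₀⟩, isPreconnected_of_forall (γ a + (δ / 2) • N a) fun p hp => ?_⟩
  obtain ⟨s, hs, t, ht, rfl, hmin⟩ := hfoot p hp
  have hp1 := hp.1
  rw [Metric.mem_thickening_iff] at hp1
  obtain ⟨_, ⟨s₁, hs₁, rfl⟩, hdist⟩ := hp1
  -- Height r over γ s₁ keeps both endpoints in the ball of radius δ about γ s₁, and this convex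
  -- ball lies in the thickening. Minimality of t gives t ≤ r.
  set r := dist (γ s + t • N s) (γ s₁) with hr
  have htr : t ≤ r := by rw [hr, dist_eq_norm]; exact hmin s₁ (hab hs₁)
  have hseg := h.segment_subset_sideSet hs (hab hs₁) ht htr
    (by rw [hr, dist_eq_norm]) (hdist.trans hδ)
  have hq : γ s₁ + r • N s₁ ∈ S := ⟨(s₁, r), ⟨hs₁, ht.trans_le htr, hdist⟩, rfl⟩
  refine ⟨segment ℝ (γ s + t • N s) (γ s₁ + r • N s₁) ∪ S, union_subset ?_ hSV, .inr hx₀,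
    .inl (left_mem_segment _ _ _), ?_⟩
  · refine subset_inter ?_ hseg
    refine Subset.trans ((convex_ball (γ s₁) δ).segment_subset hdist ?_)
      (Metric.ball_subset_thickening (mem_image_of_mem _ hs₁) δ)
    rw [Metric.mem_ball, dist_eq_norm, add_sub_cancel_left, norm_smul,
      h.norm_normal s₁ (hab hs₁), mul_one, Real.norm_eq_abs, abs_of_pos (ht.trans_le htr)]
    exact hdist
  · exact (convex_segment _ _).isPreconnected.union _ (right_mem_segment _ _ _) hq hSc

theorem image_subset_frontier_sideStrip (h : IsTransverseFrame γ T N c d ρ)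
    (hab : Icc a b ⊆ Icc c d) (hδ0 : 0 < δ) (hδ : δ < ρ / 4) :
    γ '' Icc a b ⊆ frontier (sideStrip γ N a b c d ρ δ) := by
  rintro _ ⟨s, hs, rfl⟩
  rw [(isOpen_sideStrip _ _ _ _ _ _ _ _).frontier_eq]
  refine ⟨?_, fun hmem => h.notMem_sideSet (hab hs) hmem.2⟩
  have hlim : Tendsto (fun t : ℝ => γ s + t • N s) (𝓝[>] 0) (𝓝 (γ s)) := by
    have : Continuous fun t : ℝ => γ s + t • N s := by fun_prop
    simpa using (this.tendsto 0).mono_left nhdsWithin_le_nhds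
  refine mem_closure_of_tendsto hlim ?_
  filter_upwards [Ioo_mem_nhdsGT hδ0] with t ht
  exact h.add_smul_mem_sideStrip hab hδ hs ht

end IsTransverseFrame

namespace IsSimpleRegularArc

variable {γ : ℝ → Plane} {a b c d : ℝ}

/-- The two sides of a thin neighbourhood of an arc. -/
theorem exists_thickening_diff_eq (h : IsSimpleRegularArc γ c d) (hca : c < a) (hab : a < b)
    (hbd : b < d) {ρ : ℝ}
    (hF : IsTransverseFrame γ (unitTangent γ c d) (unitNormal γ c d) c d ρ) :
    ∃ δ₀ > 0, δ₀ < ρ / 4 ∧ ∀ δ ∈ Ioo 0 δ₀,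
      Metric.thickening δ (γ '' Icc a b) \ γ '' Icc c d =
        sideStrip γ (unitNormal γ c d) a b c d ρ δ ∪
          sideStrip γ (-unitNormal γ c d) a b c d ρ δ ∧
      IsConnected (sideStrip γ (unitNormal γ c d) a b c d ρ δ) ∧
      IsConnected (sideStrip γ (-unitNormal γ c d) a b c d ρ δ) := by
  have hsub : Icc a b ⊆ Icc c d := Icc_subset_Icc hca.le hbd.le
  have hρ := hF.pos
  obtain ⟨κ, hκ, hsep⟩ := h.exists_dist_lt (lt_min (sub_pos.2 hca) (sub_pos.2 hbd))
  -- δ < κ/2 makes every parameter whose point is within 2δ of Γ interior to [c, d]; δ < ρ/8 leaves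
  -- room for the cones.
  refine ⟨min (ρ / 8) (κ / 2), by positivity, (min_le_left _ _).trans_lt (by linarith),
    fun δ hδ => ?_⟩
  have hδρ : δ < ρ / 8 := hδ.2.trans_le (min_le_left _ _)
  have hδκ : δ < κ / 2 := hδ.2.trans_le (min_le_right _ _)
  have hfoot : ∀ p ∈ Metric.thickening δ (γ '' Icc a b), p ∉ γ '' Icc c d → _ :=
    fun p hp hp' => h.exists_eq_add_smul_unitNormal hsub (fun s hs s' hs' hlt => by
      have h1 := hsep s (hsub hs) s' hs' (by linarith)
      have h2 := abs_lt.1 (h1.trans_le (min_le_left _ _))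
      have h3 := abs_lt.1 (h1.trans_le (min_le_right _ _))
      exact ⟨by linarith [hs.1], by linarith [hs.2]⟩) hp hp'
  have hoff : ∀ p ∈ γ '' Icc c d, p ∉ sideSet γ (unitNormal γ c d) c d (ρ / 2) ∧
      p ∉ sideSet γ (-unitNormal γ c d) c d (ρ / 2) := by
    rintro _ ⟨s, hs, rfl⟩
    exact ⟨hF.notMem_sideSet hs, hF.neg.notMem_sideSet hs⟩
  have hpos : ∀ s ∈ Icc c d, ∀ t, 0 < t → |t| < δ → γ s + t • unitNormal γ c d s ∈
      sideSet γ (unitNormal γ c d) c d (ρ / 2) := fun s hs t ht htδ =>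
    hF.add_smul_mem_sideSet hs ht (by rw [abs_of_pos ht] at htδ; linarith)
  have hneg : ∀ s ∈ Icc c d, ∀ t, t < 0 → |t| < δ → γ s + t • unitNormal γ c d s ∈
      sideSet γ (-unitNormal γ c d) c d (ρ / 2) := fun s hs t ht htδ => by
    have := hF.neg.add_smul_mem_sideSet hs (t := -t) (by linarith)
      (by rw [abs_of_neg ht] at htδ; linarith)
    simpa using this
  refine ⟨?_, ?_, ?_⟩
  · ext p
    constructor
    · rintro ⟨hp, hp'⟩
      obtain ⟨s, hs, t, ht0, htδ, rfl, -⟩ := hfoot p hp hp'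
      rcases ht0.lt_or_gt with ht | ht
      · exact .inr ⟨hp, hneg s hs t ht htδ⟩
      · exact .inl ⟨hp, hpos s hs t ht htδ⟩
    · rintro (hp | hp)
      · exact ⟨hp.1, fun hmem => (hoff p hmem).1 hp.2⟩
      · exact ⟨hp.1, fun hmem => (hoff p hmem).2 hp.2⟩
  · refine hF.isConnected_sideStrip hsub hab hδ.1 (by linarith) fun p hp => ?_
    obtain ⟨s, hs, t, ht0, htδ, rfl, hmin⟩ := hfoot p hp.1 fun hmem => (hoff p hmem).1 hp.2
    rcases ht0.lt_or_gt with ht | ht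
    · exact (disjoint_left.1 hF.disjoint_sideSet_neg hp.2 (hneg s hs t ht htδ)).elim
    · rw [abs_of_pos ht] at hmin
      exact ⟨s, hs, t, ht, rfl, hmin⟩
  · refine hF.neg.isConnected_sideStrip hsub hab hδ.1 (by linarith) fun p hp => ?_
    obtain ⟨s, hs, t, ht0, htδ, rfl, hmin⟩ := hfoot p hp.1 fun hmem => (hoff p hmem).2 hp.2
    rcases ht0.lt_or_gt with ht | ht
    · rw [abs_of_neg ht] at hmin
      exact ⟨s, hs, -t, by linarith, by simp, hmin⟩
    · exact (disjoint_left.1 hF.disjoint_sideSet_neg (hpos s hs t ht htδ) hp.2).elim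

end IsSimpleRegularArc

/-! ### Quantitative estimates on the arc -/

/-- Points closer than ρ are handled by near-straightness and the lower bound on the speed; for the
others the chord is at least ρ and |s - s'| ≤ d - c. -/
theorem IsSimpleRegularArc.exists_mul_abs_sub_le {γ : ℝ → Plane} {c d : ℝ}
    (h : IsSimpleRegularArc γ c d) :
    ∃ k > 0, ∀ s ∈ Icc c d, ∀ s' ∈ Icc c d, k * |s - s'| ≤ ‖γ s - γ s'‖ := by
  obtain ⟨m, hm, hmle⟩ := h.exists_le_norm_velocity
  obtain ⟨ρ, hρ, H⟩ := h.exists_norm_sub_sub_smul_le (half_pos hm)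
  have hcd : 0 < d - c := sub_pos.2 h.lt
  refine ⟨min (m / 2) (ρ / (d - c)), by positivity, fun s hs s' hs' => ?_⟩
  rcases lt_or_ge ‖γ s - γ s'‖ ρ with hlt | hge
  · have h1 := (H s hs s' hs' hlt s' right_mem_uIcc).2
    have h2 : |s' - s| * m ≤ m / 2 * |s' - s| + ‖γ s - γ s'‖ := by
      calc |s' - s| * m ≤ ‖(s' - s) • velocity γ c d s‖ := by
            rw [norm_smul, Real.norm_eq_abs]; gcongr; exact hmle s hs
        _ = ‖-(γ s' - γ s - (s' - s) • velocity γ c d s) - (γ s - γ s')‖ := by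
            congr 1; module
        _ ≤ _ := (norm_sub_le _ _).trans (by rw [norm_neg]; gcongr)
    calc _ ≤ m / 2 * |s - s'| := by gcongr; exact min_le_left _ _
      _ ≤ _ := by rw [abs_sub_comm s' s] at h2; linarith
  · calc _ ≤ ρ / (d - c) * |s - s'| := by gcongr; exact min_le_right _ _
      _ ≤ ρ / (d - c) * (d - c) := by
        gcongr; rw [abs_le]; constructor <;> linarith [hs.1, hs.2, hs'.1, hs'.2]
      _ = ρ := div_mul_cancel₀ _ hcd.ne'
      _ ≤ _ := hge

/-- Lets estimates for the normal computed within [a, b] apply to the normal of the extension, which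
defines the strips. -/
theorem IsSimpleRegularArc.velocity_eqOn {γ : ℝ → Plane} {a b c d : ℝ}
    (h : IsSimpleRegularArc γ c d) (hlt : a < b) (hab : Icc a b ⊆ Icc c d) :
    EqOn (velocity γ c d) (velocity γ a b) (Icc a b) := fun s hs =>
  (((h.hasDerivWithinAt (hab hs)).mono hab).derivWithin (uniqueDiffOn_Icc hlt s hs)).symm

namespace IsSimpleAnalyticArc

variable {γ : ℝ → Plane} {a b : ℝ}

/-- Analyticity enters only here, as two continuous derivatives up to the endpoints. -/
theorem contDiffOn_velocity (h : IsSimpleAnalyticArc γ a b) :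
    ContDiffOn ℝ 1 (velocity γ a b) (Icc a b) :=
  (h.analyticOn.contDiffOn (n := 2) (uniqueDiffOn_Icc h.lt)).derivWithin (uniqueDiffOn_Icc h.lt)
    (by norm_num)

theorem exists_lipschitzOnWith_velocity (h : IsSimpleAnalyticArc γ a b) :
    ∃ K, LipschitzOnWith K (velocity γ a b) (Icc a b) :=
  h.contDiffOn_velocity.exists_lipschitzOnWith one_ne_zero (convex_Icc a b) isCompact_Icc

theorem exists_lipschitzOnWith_unitNormal (h : IsSimpleAnalyticArc γ a b) :
    ∃ K, LipschitzOnWith K (unitNormal γ a b) (Icc a b) := by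
  have h1 : ContDiffOn ℝ 1 (unitNormal γ a b) (Icc a b) :=
    quarterTurn.toContinuousLinearMap.contDiff.comp_contDiffOn
      (((h.contDiffOn_velocity.norm ℝ h.velocity_ne_zero).inv
        fun s hs => (h.norm_velocity_pos hs).ne').smul h.contDiffOn_velocity)
  exact h1.exists_lipschitzOnWith one_ne_zero (convex_Icc a b) isCompact_Icc

/-- The arc deviates quadratically from its tangent lines. -/
theorem exists_abs_inner_unitNormal_le (h : IsSimpleAnalyticArc γ a b) :
    ∃ K : ℝ, 0 ≤ K ∧ ∀ s ∈ Icc a b, ∀ s' ∈ Icc a b,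
      |inner ℝ (unitNormal γ a b s) (γ s - γ s')| ≤ K * |s - s'| ^ 2 := by
  obtain ⟨K, hK⟩ := h.exists_lipschitzOnWith_velocity
  refine ⟨K, K.2, fun s hs s' hs' => ?_⟩
  have hsub : uIcc s s' ⊆ Icc a b := by
    rw [← uIcc_of_le h.lt.le] at hs hs' ⊢; exact uIcc_subset_uIcc hs hs'
  have h1 := h.norm_sub_sub_smul_le hs hs' (u := velocity γ a b s) (ε := K * |s - s'|)
    fun r hr => by
      rw [← dist_eq_norm]
      refine (hK.dist_le_mul r (hsub hr) s hs).trans ?_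
      rw [Real.dist_eq, abs_sub_comm s]
      gcongr ?_ * ?_
      exact abs_sub_left_of_mem_uIcc hr
  have h2 : inner ℝ (unitNormal γ a b s) (γ s - γ s') =
      -inner ℝ (unitNormal γ a b s) (γ s' - γ s - (s' - s) • velocity γ a b s) := by
    rw [inner_sub_right _ (γ s' - γ s), inner_smul_right, h.inner_unitNormal_velocity hs,
      ← neg_sub (γ s'), inner_neg_right]; ring
  rw [h2, abs_neg]
  refine (abs_real_inner_le_norm _ _).trans ?_
  rw [h.norm_unitNormal hs, one_mul]
  refine h1.trans_eq ?_
  rw [abs_sub_comm s']; ring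

end IsSimpleAnalyticArc

/-! ### Bi-Lipschitz normal coordinates over Γ -/

/-- A unit vector field `N` along the arc `γ` for which `(s, t) ↦ γ s + t N s` parametrizes a
tubular neighbourhood of radius `δ₀` in a bi-Lipschitz way. -/
structure IsTubularField (γ N : ℝ → Plane) (a b k δ₀ : ℝ) : Prop where
  pos : 0 < k
  continuousOn : ContinuousOn N (Icc a b)
  norm_eq : ∀ s ∈ Icc a b, ‖N s‖ = 1
  le_norm_sub : ∀ s ∈ Icc a b, ∀ s' ∈ Icc a b, ∀ t ∈ Icc 0 δ₀, ∀ t' ∈ Icc 0 δ₀,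
    k * max |s - s'| |t - t'| ≤ ‖γ s + t • N s - (γ s' + t' • N s')‖
  le_norm : ∀ s ∈ Icc a b, ∀ s' ∈ Icc a b, ∀ t ∈ Icc 0 δ₀, t ≤ ‖γ s + t • N s - γ s'‖

theorem exists_isTubularField_of_lipschitzOnWith {γ N : ℝ → Plane} {a b k K : ℝ} {L : NNReal}
    (hk : 0 < k) (hK : 0 ≤ K)
    (hγ : ∀ s ∈ Icc a b, ∀ s' ∈ Icc a b, k * |s - s'| ≤ ‖γ s - γ s'‖)
    (hN : LipschitzOnWith L N (Icc a b)) (hN1 : ∀ s ∈ Icc a b, ‖N s‖ = 1)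
    (hflat : ∀ s ∈ Icc a b, ∀ s' ∈ Icc a b, |inner ℝ (N s) (γ s - γ s')| ≤ K * |s - s'| ^ 2) :
    ∃ k' δ₀, 0 < δ₀ ∧ IsTubularField γ N a b k' δ₀ := by
  -- The second bound lets the cross term 2t⟨N s', γ s - γ s'⟩ absorb at most half of k²|s - s'|²;
  -- the first makes replacing N s by N s' cost at most k|s - s'|/4.
  set δ₀ := min (k / (4 * (L + 1))) (k ^ 2 / (4 * (K + 1))) with hδ₀
  have hL0 : (0 : ℝ) ≤ L := L.2
  have hpos : 0 < δ₀ := lt_min (by positivity) (by positivity)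
  have h1 : δ₀ * L ≤ k / 4 := by
    have : δ₀ * (4 * (L + 1)) ≤ k := (le_div_iff₀ (by positivity)).1 (min_le_left _ _)
    nlinarith
  have h2 : δ₀ * K ≤ k ^ 2 / 4 := by
    have : δ₀ * (4 * (K + 1)) ≤ k ^ 2 := (le_div_iff₀ (by positivity)).1 (min_le_right _ _)
    nlinarith
  have key : ∀ s ∈ Icc a b, ∀ s' ∈ Icc a b, ∀ t ∈ Icc (-δ₀) δ₀,
      k ^ 2 / 2 * |s - s'| ^ 2 + t ^ 2 ≤ ‖γ s - γ s' + t • N s'‖ ^ 2 := by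
    intro s hs s' hs' t ht
    have h3 : |inner ℝ (N s') (γ s - γ s')| ≤ K * |s - s'| ^ 2 := by
      rw [← neg_sub (γ s'), inner_neg_right, abs_neg, abs_sub_comm]; exact hflat s' hs' s hs
    rw [norm_add_sq_real, inner_smul_right, norm_smul, hN1 s' hs', mul_one, Real.norm_eq_abs,
      sq_abs t, real_inner_comm]
    have h4 : (k * |s - s'|) ^ 2 ≤ ‖γ s - γ s'‖ ^ 2 := by gcongr; exact hγ s hs s' hs'
    have h5 : |t * inner ℝ (N s') (γ s - γ s')| ≤ k ^ 2 / 4 * |s - s'| ^ 2 := by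
      rw [abs_mul]
      calc _ ≤ δ₀ * (K * |s - s'| ^ 2) := by gcongr; exact abs_le.2 ht
        _ = δ₀ * K * |s - s'| ^ 2 := by ring
        _ ≤ _ := by gcongr
    nlinarith [(abs_le.1 h5).1]
  refine ⟨min (k / 4) (1 / 2), δ₀, hpos, lt_min (by positivity) (by norm_num), hN.continuousOn,
    hN1, ?_, ?_⟩
  · intro s hs s' hs' t ht t' ht'
    have h3 := key s hs s' hs' (t - t')
      ⟨by linarith [ht.1, ht'.2], by linarith [ht.2, ht'.1]⟩
    have h4 : (k * |s - s'| + |t - t'|) / 2 ≤ ‖γ s - γ s' + (t - t') • N s'‖ := by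
      refine le_of_sq_le_sq (α := ℝ) ?_ (norm_nonneg _)
      refine le_trans ?_ h3
      rw [← sq_abs (t - t')]
      nlinarith [sq_nonneg (k * |s - s'| - |t - t'|)]
    have h5 : ‖t • (N s - N s')‖ ≤ k / 4 * |s - s'| := by
      rw [norm_smul, Real.norm_eq_abs, abs_of_nonneg ht.1, ← dist_eq_norm]
      calc _ ≤ δ₀ * (L * dist s s') := by
            gcongr
            · exact ht.2
            · exact hN.dist_le_mul s hs s' hs'
        _ = δ₀ * L * |s - s'| := by rw [Real.dist_eq]; ring
        _ ≤ _ := by gcongr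
    have h6 : γ s + t • N s - (γ s' + t' • N s') =
        (γ s - γ s' + (t - t') • N s') + t • (N s - N s') := by module
    have h7 := norm_sub_le_norm_add (γ s - γ s' + (t - t') • N s') (t • (N s - N s'))
    rw [h6, mul_max_of_nonneg _ _ (by positivity)]
    have h8 : min (k / 4) (1 / 2) * |s - s'| ≤ k / 4 * |s - s'| := by
      gcongr; exact min_le_left _ _
    have h9 : min (k / 4) (1 / 2) * |t - t'| ≤ 1 / 2 * |t - t'| := by
      gcongr; exact min_le_right _ _
    have := abs_nonneg (t - t')
    have := mul_nonneg hk.le (abs_nonneg (s - s'))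
    exact max_le (by linarith) (by linarith)
  · intro s hs s' hs' t ht
    have h3 := key s' hs' s hs (-t) ⟨by linarith [ht.2], by linarith [ht.1, hpos]⟩
    have h4 : γ s + t • N s - γ s' = -(γ s' - γ s + (-t) • N s) := by module
    rw [h4, norm_neg]
    refine le_of_sq_le_sq (α := ℝ) ?_ (norm_nonneg _)
    have : 0 ≤ k ^ 2 / 2 * |s' - s| ^ 2 := by positivity
    nlinarith

/-- Both unit normal fields of an analytic arc are tubular. -/
theorem IsSimpleAnalyticArc.exists_isTubularField {γ : ℝ → Plane} {a b c d : ℝ}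
    (h : IsSimpleAnalyticArc γ a b) (hext : IsSimpleRegularArc γ c d)
    (hab : Icc a b ⊆ Icc c d) :
    (∃ k δ₀, 0 < δ₀ ∧ IsTubularField γ (unitNormal γ c d) a b k δ₀) ∧
    (∃ k δ₀, 0 < δ₀ ∧ IsTubularField γ (-unitNormal γ c d) a b k δ₀) := by
  obtain ⟨k, hk, hkγ⟩ := h.exists_mul_abs_sub_le
  obtain ⟨L, hL⟩ := h.exists_lipschitzOnWith_unitNormal
  obtain ⟨K, hK, hflat⟩ := h.exists_abs_inner_unitNormal_le
  have heq : EqOn (unitNormal γ c d) (unitNormal γ a b) (Icc a b) := fun s hs => by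
    rw [unitNormal, unitNormal, unitTangent, unitTangent, hext.velocity_eqOn h.lt hab hs]
  constructor
  · refine exists_isTubularField_of_lipschitzOnWith (L := L) hk hK hkγ ?_ ?_ ?_
    · exact fun s hs s' hs' => by rw [heq hs, heq hs']; exact hL hs hs'
    · exact fun s hs => by rw [heq hs]; exact h.norm_unitNormal hs
    · exact fun s hs => by rw [heq hs]; exact hflat s hs
  · refine exists_isTubularField_of_lipschitzOnWith (L := L) hk hK hkγ ?_ ?_ ?_
    · intro s hs s' hs'
      rw [Pi.neg_apply, Pi.neg_apply, heq hs, heq hs', edist_neg_neg]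
      exact hL hs hs'
    · exact fun s hs => by rw [Pi.neg_apply, norm_neg, heq hs]; exact h.norm_unitNormal hs
    · exact fun s hs s' hs' => by
        rw [Pi.neg_apply, inner_neg_left, abs_neg, heq hs]; exact hflat s hs s' hs'

/-! ### Hausdorff measure under Lipschitz and expanding maps -/

section Measure

open Measure NNReal ENNReal

theorem hausdorffMeasure_le_image_of_edist_le {X Y : Type*} [EMetricSpace X] [EMetricSpace Y]
    [MeasurableSpace X] [BorelSpace X] [MeasurableSpace Y] [BorelSpace Y] {f : X → Y} {s : Set X}
    {K : ℝ≥0} (hf : ∀ x ∈ s, ∀ y ∈ s, edist x y ≤ K * edist (f x) (f y)) {d : ℝ} (hd : 0 ≤ d) :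
    μH[d] s ≤ (K : ℝ≥0∞) ^ d * μH[d] (f '' s) := by
  rcases isEmpty_or_nonempty X with hX | hX
  · simp [Set.eq_empty_of_isEmpty s]
  have hinj : InjOn f s := fun x hx y hy hxy => by
    have := hf x hx y hy
    rwa [hxy, edist_self, mul_zero, nonpos_iff_eq_zero, edist_eq_zero] at this
  have hinv : LipschitzOnWith K (Function.invFunOn f s) (f '' s) := by
    rintro _ ⟨x, hx, rfl⟩ _ ⟨y, hy, rfl⟩
    rw [hinj.leftInvOn_invFunOn hx, hinj.leftInvOn_invFunOn hy]
    exact hf x hx y hy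
  have := hinv.hausdorffMeasure_image_le hd
  rwa [hinj.invFunOn_image subset_rfl] at this

/-- Change of variables inequality for an expanding map. -/
theorem setLIntegral_comp_le_of_edist_le {X Y : Type*} [EMetricSpace X] [EMetricSpace Y]
    [MeasurableSpace X] [BorelSpace X] [MeasurableSpace Y] [BorelSpace Y] {f : X → Y} {s : Set X}
    {t : Set Y} {K : ℝ≥0} (hf : ∀ x ∈ s, ∀ y ∈ s, edist x y ≤ K * edist (f x) (f y))
    (hst : MapsTo f s t) {d : ℝ} (hd : 0 ≤ d) (hs : MeasurableSet s)
    (hfm : AEMeasurable f (μH[d].restrict s))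
    {F : Y → ℝ≥0∞} (hF : Measurable F) :
    ∫⁻ x in s, F (f x) ∂μH[d] ≤ (K : ℝ≥0∞) ^ d * ∫⁻ y in t, F y ∂μH[d] := by
  rw [← lintegral_map' hF.aemeasurable hfm, ← smul_eq_mul, ← lintegral_smul_measure]
  refine lintegral_mono' (Measure.le_iff.2 fun B hB => ?_) le_rfl
  rw [Measure.map_apply_of_aemeasurable hfm hB, Measure.smul_apply, smul_eq_mul,
    Measure.restrict_apply hB, Measure.restrict_apply' hs]
  refine (hausdorffMeasure_le_image_of_edist_le (f := f)
    (fun x hx y hy => hf x hx.2 y hy.2) hd).trans ?_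
  gcongr
  rintro _ ⟨x, hx, rfl⟩
  exact ⟨hx.1, hst hx.2⟩

/-- Change of variables inequality for a Lipschitz map. -/
theorem setLIntegral_image_le_of_lipschitzOnWith {X Y : Type*} [EMetricSpace X] [EMetricSpace Y]
    [MeasurableSpace X] [BorelSpace X] [MeasurableSpace Y] [BorelSpace Y] {f : X → Y} {s : Set X}
    {K : ℝ≥0} (hf : LipschitzOnWith K f s) {d : ℝ} (hd : 0 ≤ d) (hs : MeasurableSet s)
    (hfm : AEMeasurable f (μH[d].restrict s)) {F : Y → ℝ≥0∞} (hF : Measurable F) :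
    ∫⁻ y in f '' s, F y ∂μH[d] ≤ (K : ℝ≥0∞) ^ d * ∫⁻ x in s, F (f x) ∂μH[d] := by
  rw [← lintegral_map' hF.aemeasurable hfm, ← smul_eq_mul, ← lintegral_smul_measure]
  refine lintegral_mono' (Measure.le_iff.2 fun B hB => ?_) le_rfl
  rw [Measure.smul_apply, Measure.map_apply_of_aemeasurable hfm hB, smul_eq_mul,
    Measure.restrict_apply hB, Measure.restrict_apply' hs, inter_comm B,
    ← image_inter_preimage, inter_comm s]
  exact (hf.mono inter_subset_right).hausdorffMeasure_image_le hd

/-- The identity from the sup-norm plane, where μH[2] is Lebesgue measure, to the Euclidean plane is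
√2-Lipschitz, and √2² = 2. The sharp constant is not needed. -/
theorem hausdorffMeasure_two_plane_le (B : Set Plane) :
    μH[2] B ≤ 2 * volume B := by
  have h1 : LipschitzWith (((Fintype.card (Fin 2) : ℝ≥0)) ^ (1 / (2 : ℝ≥0∞)).toReal)
      (WithLp.toLp 2 : (Fin 2 → ℝ) → Plane) := PiLp.lipschitzWith_toLp 2 _
  have h2 := (h1.lipschitzOnWith (s := WithLp.toLp 2 ⁻¹' B)).hausdorffMeasure_image_le
    (d := 2) zero_le_two
  rw [image_preimage_eq _ (WithLp.toLp_surjective 2)] at h2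
  refine h2.trans_eq ?_
  have h3 : (μH[2] : Measure (Fin 2 → ℝ)) = volume := by
    simpa using hausdorffMeasure_pi_real (ι := Fin 2)
  rw [h3, (PiLp.volume_preserving_toLp (Fin 2)).measure_preimage_emb
    (MeasurableEquiv.toLp 2 (Fin 2 → ℝ)).measurableEmbedding]
  congr 1
  rw [← ENNReal.coe_rpow_of_nonneg _ zero_le_two, ← NNReal.rpow_mul]
  norm_num

theorem sq_lintegral_le {α : Type*} [MeasurableSpace α] (μ : Measure α) {f : α → ℝ≥0∞}
    (hf : AEMeasurable f μ) : (∫⁻ x, f x ∂μ) ^ 2 ≤ μ univ * ∫⁻ x, f x ^ 2 ∂μ := by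
  have h := ENNReal.lintegral_mul_le_Lp_mul_Lq μ Real.HolderConjugate.two_two hf
    (aemeasurable_const (b := (1 : ℝ≥0∞)))
  simp only [Pi.mul_apply, mul_one, ENNReal.one_rpow, lintegral_const, one_mul] at h
  have h2 := pow_le_pow_left' h 2
  refine h2.trans_eq ?_
  rw [mul_pow, ← ENNReal.rpow_mul_natCast, ← ENNReal.rpow_mul_natCast, mul_comm]
  norm_num

theorem ENNReal.add_sq_le (x y : ℝ≥0∞) : (x + y) ^ 2 ≤ 2 * (x ^ 2 + y ^ 2) := by
  have := ENNReal.rpow_add_le_mul_rpow_add_rpow x y one_le_two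
  norm_num at this
  exact this

end Measure

/-! ### Poincaré inequality across a strip -/

section Energy

open Measure NNReal ENNReal

theorem norm_gradient_eq_norm_fderiv (φ : Plane → ℝ) (x : Plane) :
    ‖gradient φ x‖ = ‖fderiv ℝ φ x‖ := by
  rw [gradient, LinearIsometryEquiv.norm_map]

theorem continuous_gradient {φ : Plane → ℝ} (hφ : ContDiff ℝ 1 φ) : Continuous (gradient φ) :=
  (InnerProductSpace.toDual ℝ Plane).symm.continuous.comp (hφ.continuous_fderiv one_ne_zero)

/-- Fundamental theorem of calculus along the segment from p to p + δn; Cauchy–Schwarz on an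
interval of length δ supplies the factor δ. -/
theorem enorm_sq_le_add_setLIntegral {φ : Plane → ℝ} (hφ : ContDiff ℝ 1 φ) {n : Plane}
    (hn : ‖n‖ = 1) (p : Plane) {δ : ℝ} (hδ : 0 ≤ δ) :
    ‖φ p‖ₑ ^ 2 ≤ 2 * (‖φ (p + δ • n)‖ₑ ^ 2 +
      ENNReal.ofReal δ * ∫⁻ t in Ioo 0 δ, ‖gradient φ (p + t • n)‖ₑ ^ 2) := by
  have hline : ∀ t : ℝ, HasDerivAt (fun t : ℝ => p + t • n) n t := fun t => by
    simpa using ((hasDerivAt_id t).smul_const n).const_add p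
  have hder : ∀ t ∈ uIcc 0 δ, HasDerivAt (fun t : ℝ => φ (p + t • n))
      (fderiv ℝ φ (p + t • n) n) t := fun t _ =>
    ((hφ.differentiable one_ne_zero _).hasFDerivAt).comp_hasDerivAt t (hline t)
  have hcont : Continuous fun t : ℝ => fderiv ℝ φ (p + t • n) n :=
    ((hφ.continuous_fderiv one_ne_zero).comp (by fun_prop)).clm_apply continuous_const
  have hftc := intervalIntegral.integral_eq_sub_of_hasDerivAt hder
    (hcont.intervalIntegrable 0 δ)
  rw [intervalIntegral.integral_of_le hδ, zero_smul, add_zero] at hftc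
  have h1 : ‖φ p‖ₑ ≤ ‖φ (p + δ • n)‖ₑ + ∫⁻ t in Ioo 0 δ, ‖gradient φ (p + t • n)‖ₑ := by
    have h2 : φ p = φ (p + δ • n) - ∫ t in Ioc 0 δ, fderiv ℝ φ (p + t • n) n := by
      rw [hftc]; ring
    calc ‖φ p‖ₑ ≤ ‖φ (p + δ • n)‖ₑ + ‖∫ t in Ioc 0 δ, fderiv ℝ φ (p + t • n) n‖ₑ := by
          conv_lhs => rw [h2]
          exact enorm_sub_le
      _ ≤ ‖φ (p + δ • n)‖ₑ + ∫⁻ t in Ioc 0 δ, ‖fderiv ℝ φ (p + t • n) n‖ₑ := by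
          gcongr; exact enorm_integral_le_lintegral_enorm _
      _ = ‖φ (p + δ • n)‖ₑ + ∫⁻ t in Ioo 0 δ, ‖fderiv ℝ φ (p + t • n) n‖ₑ := by
          rw [Measure.restrict_congr_set Ioo_ae_eq_Ioc]
      _ ≤ _ := by
          gcongr with t
          rw [enorm_le_iff_norm_le, norm_gradient_eq_norm_fderiv]
          simpa [hn] using (fderiv ℝ φ (p + t • n)).le_opNorm n
  have hmeas : Measurable fun t : ℝ => ‖gradient φ (p + t • n)‖ₑ :=
    ((continuous_gradient hφ).comp (by fun_prop)).enorm.measurable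
  refine (pow_le_pow_left' h1 2).trans ((ENNReal.add_sq_le _ _).trans ?_)
  gcongr
  simpa using sq_lintegral_le (volume.restrict (Ioo 0 δ)) hmeas.aemeasurable

theorem setLIntegral_hausdorffMeasure_two_le (A : Set Plane) (F : Plane → ℝ≥0∞) :
    ∫⁻ x in A, F x ∂μH[2] ≤ 2 * ∫⁻ x in A, F x := by
  rw [← smul_eq_mul, ← lintegral_smul_measure, ← Measure.restrict_smul]
  refine lintegral_mono' (Measure.restrict_mono subset_rfl (Measure.le_iff.2 fun B _ => ?_)) le_rfl
  simpa using hausdorffMeasure_two_plane_le B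

/-- Poincaré type inequality in a tubular neighbourhood of width `δ`: the trace on the arc is
controlled by the trace on the parallel arc and `δ` times the Dirichlet integral. -/
theorem IsTubularField.exists_setLIntegral_enorm_sq_le {γ N : ℝ → Plane} {a b k δ₀ : ℝ} {M : ℝ≥0}
    (hN : IsTubularField γ N a b k δ₀) (hγ : LipschitzOnWith M γ (Icc a b)) :
    ∃ C : ℝ≥0, ∀ δ ∈ Ioc 0 δ₀, ∀ A S : Set Plane,
      (∀ s ∈ Icc a b, ∀ t ∈ Ioo 0 δ, γ s + t • N s ∈ A) →
      (∀ s ∈ Icc a b, γ s + δ • N s ∈ S) → ∀ φ : Plane → ℝ, ContDiff ℝ 1 φ →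
      ∫⁻ x in γ '' Icc a b, ‖φ x‖ₑ ^ 2 ∂μH[1] ≤
        C * (∫⁻ x in S, ‖φ x‖ₑ ^ 2 ∂μH[1] +
          ENNReal.ofReal δ * ∫⁻ x in A, ‖gradient φ x‖ₑ ^ 2) := by
  set K : ℝ≥0 := k⁻¹.toNNReal with hK
  have hk := hN.pos
  have hanti : ∀ δ ∈ Ioc 0 δ₀, ∀ x ∈ Icc a b ×ˢ Icc 0 δ, ∀ y ∈ Icc a b ×ˢ Icc 0 δ,
      edist x y ≤ K * edist (γ x.1 + x.2 • N x.1) (γ y.1 + y.2 • N y.1) := by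
    intro δ hδ x hx y hy
    have h1 := hN.le_norm_sub x.1 hx.1 y.1 hy.1 x.2 ⟨hx.2.1, hx.2.2.trans hδ.2⟩ y.2
      ⟨hy.2.1, hy.2.2.trans hδ.2⟩
    rw [edist_dist, edist_dist, ← ENNReal.ofReal_coe_nnreal, ← ENNReal.ofReal_mul (NNReal.coe_nonneg K)]
    refine ENNReal.ofReal_le_ofReal ?_
    rw [hK, Real.coe_toNNReal _ (inv_pos.2 hk).le, Prod.dist_eq, Real.dist_eq, Real.dist_eq,
      dist_eq_norm, inv_mul_eq_div, le_div_iff₀ hk, mul_comm]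
    exact h1
  have hγc := hγ.continuousOn
  refine ⟨2 * M * (K + 2 * K ^ 2), fun δ hδ A S hA hS φ hφ => ?_⟩
  have hFm : Measurable fun x => ‖φ x‖ₑ ^ 2 := hφ.continuous.enorm.measurable.pow_const 2
  have hGm : Measurable fun x => ‖gradient φ x‖ₑ ^ 2 :=
    (continuous_gradient hφ).enorm.measurable.pow_const 2
  have hγm : AEMeasurable γ ((μH[1] : Measure ℝ).restrict (Icc a b)) :=
    hγc.aemeasurable measurableSet_Icc
  have hΨc : ContinuousOn (fun x : ℝ × ℝ => γ x.1 + x.2 • N x.1) (Icc a b ×ˢ Ioo 0 δ) :=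
    (hγc.comp continuousOn_fst fun q hq => hq.1).add
      (continuousOn_snd.smul (hN.continuousOn.comp continuousOn_fst fun q hq => hq.1))
  have hΨm : MeasurableSet (Icc a b ×ˢ Ioo 0 δ) := measurableSet_Icc.prod measurableSet_Ioo
  -- Three one-sided changes of variables: Γ to [a, b] by the Lipschitz bound on γ, then [a, b] to
  -- the parallel arc and the rectangle to the strip by expansion of the normal map.
  have step1 := setLIntegral_image_le_of_lipschitzOnWith hγ zero_le_one measurableSet_Icc hγm hFm
  have step2 := setLIntegral_comp_le_of_edist_le (f := fun s => γ s + δ • N s) (s := Icc a b)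
    (t := S) (K := K) (fun x hx y hy => by
      have := hanti δ hδ (x, δ) ⟨hx, right_mem_Icc.2 hδ.1.le⟩ (y, δ)
        ⟨hy, right_mem_Icc.2 hδ.1.le⟩
      rwa [Prod.edist_eq, edist_self, max_eq_left zero_le] at this)
    hS zero_le_one measurableSet_Icc
    ((hγc.add (hN.continuousOn.const_smul δ)).aemeasurable measurableSet_Icc) hFm
  have step3 := setLIntegral_comp_le_of_edist_le (d := 2)
    (f := fun x : ℝ × ℝ => γ x.1 + x.2 • N x.1) (s := Icc a b ×ˢ Ioo 0 δ) (t := A) (K := K)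
    (fun x hx y hy => hanti δ hδ x ⟨hx.1, Ioo_subset_Icc_self hx.2⟩ y
      ⟨hy.1, Ioo_subset_Icc_self hy.2⟩)
    (fun x hx => hA x.1 hx.1 x.2 hx.2) zero_le_two hΨm (hΨc.aemeasurable hΨm) hGm
  rw [hausdorffMeasure_real] at step1 step2
  -- ℝ × ℝ carries the sup metric, so here μH[2] is exactly Lebesgue measure; hence the `max` in
  -- `le_norm_sub`.
  rw [hausdorffMeasure_prod_real] at step3
  have hfub : ∫⁻ x in Icc a b ×ˢ Ioo 0 δ, ‖gradient φ (γ x.1 + x.2 • N x.1)‖ₑ ^ 2 =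
      ∫⁻ s in Icc a b, ∫⁻ t in Ioo 0 δ, ‖gradient φ (γ s + t • N s)‖ₑ ^ 2 := by
    rw [Measure.volume_eq_prod, ← Measure.prod_restrict, lintegral_prod]
    rw [Measure.prod_restrict, ← Measure.volume_eq_prod]
    exact hGm.comp_aemeasurable (hΨc.aemeasurable hΨm)
  rw [hfub] at step3
  have step4 := step3.trans (mul_le_mul_right (setLIntegral_hausdorffMeasure_two_le A _) _)
  have hFE : AEMeasurable (fun s => ‖φ (γ s + δ • N s)‖ₑ ^ 2) (volume.restrict (Icc a b)) :=
    hFm.comp_aemeasurable ((hγc.add (hN.continuousOn.const_smul δ)).aemeasurable measurableSet_Icc)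
  have step5 : ∫⁻ s in Icc a b, ‖φ (γ s)‖ₑ ^ 2 ≤
      2 * ((∫⁻ s in Icc a b, ‖φ (γ s + δ • N s)‖ₑ ^ 2) + ENNReal.ofReal δ *
        ∫⁻ s in Icc a b, ∫⁻ t in Ioo 0 δ, ‖gradient φ (γ s + t • N s)‖ₑ ^ 2) := by
    rw [← lintegral_const_mul' _ _ ENNReal.ofReal_ne_top, ← lintegral_add_left' hFE,
      ← lintegral_const_mul' _ _ ENNReal.ofNat_ne_top]
    exact setLIntegral_mono' measurableSet_Icc fun s hs =>
      enorm_sq_le_add_setLIntegral hφ (hN.norm_eq s hs) (γ s) hδ.1.le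
  simp only [ENNReal.rpow_one, ENNReal.rpow_ofNat] at step1 step2 step4
  set X := ∫⁻ x in S, ‖φ x‖ₑ ^ 2 ∂μH[1]
  set Y := ∫⁻ x in A, ‖gradient φ x‖ₑ ^ 2
  calc _ ≤ _ := step1
    _ ≤ M * (2 * (K * X + ENNReal.ofReal δ * (K ^ 2 * (2 * Y)))) := by
      gcongr
      refine step5.trans ?_
      gcongr
    _ = 2 * M * (K * X + (2 * K ^ 2) * (ENNReal.ofReal δ * Y)) := by ring
    _ ≤ 2 * M * ((K + 2 * K ^ 2) * X + (K + 2 * K ^ 2) * (ENNReal.ofReal δ * Y)) := by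
      gcongr
      · exact le_self_add
      · exact le_add_self
    _ = _ := by push_cast; ring

theorem tendsto_eLpNorm_of_tendsto_sub {α E ι : Type*} [MeasurableSpace α] {μ : Measure α}
    [NormedAddCommGroup E] {l : Filter ι} {p : ℝ≥0∞} (hp : 1 ≤ p) {f : ι → α → E} {g : α → E}
    (hf : ∀ i, AEStronglyMeasurable (f i) μ) (hg : MemLp g p μ)
    (h : Tendsto (fun i => eLpNorm (fun x => f i x - g x) p μ) l (𝓝 0)) :
    Tendsto (fun i => eLpNorm (f i) p μ) l (𝓝 (eLpNorm g p μ)) := by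
  have h1 : Tendsto (fun i => eLpNorm g p μ - eLpNorm (fun x => f i x - g x) p μ) l
      (𝓝 (eLpNorm g p μ)) := by
    simpa using ENNReal.Tendsto.sub tendsto_const_nhds h (.inl hg.2.ne)
  have h2 : Tendsto (fun i => eLpNorm g p μ + eLpNorm (fun x => f i x - g x) p μ) l
      (𝓝 (eLpNorm g p μ)) := by
    simpa using tendsto_const_nhds.add h
  refine tendsto_of_tendsto_of_tendsto_of_le_of_le h1 h2 (fun i => ?_) fun i => ?_
  · refine tsub_le_iff_right.2 ?_
    have := eLpNorm_sub_le (hf i) ((hf i).sub hg.1) hp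
    simpa [Pi.sub_def] using this
  · have := eLpNorm_add_le hg.1 ((hf i).sub hg.1) hp
    simpa [Pi.sub_def, Pi.add_def] using this

theorem eLpNorm_two_sq {α E : Type*} [MeasurableSpace α] {μ : Measure α}
    [NormedAddCommGroup E] (f : α → E) : eLpNorm f 2 μ ^ 2 = ∫⁻ x, ‖f x‖ₑ ^ 2 ∂μ := by
  simpa using eLpNorm_nnreal_pow_eq_lintegral (p := 2) (f := f) (μ := μ) two_ne_zero

/-- An inequality between square norms of smooth functions passes to competitors. -/
theorem IsCompetitor.one_le_mul_energy {Γ A : Set Plane} {v : Plane → ℝ} {g : Plane → Plane}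
    {w : Plane → ℝ} (h : IsCompetitor Γ A v g w) (hΓ : Γ ⊆ frontier A)
    {C : ℝ≥0} {δ : ℝ} (hδ : 0 ≤ δ)
    (hC : ∀ φ : Plane → ℝ, ContDiff ℝ 1 φ → ∫⁻ x in Γ, ‖φ x‖ₑ ^ 2 ∂μH[1] ≤
      C * (∫⁻ x in frontier A \ Γ, ‖φ x‖ₑ ^ 2 ∂μH[1] +
        ENNReal.ofReal δ * ∫⁻ x in A, ‖gradient φ x‖ₑ ^ 2)) :
    1 ≤ C * δ * ∫ x in A, ‖g x‖ ^ 2 := by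
  obtain ⟨hw, φ, hφ, -, hgrad, hbd⟩ := h.trace
  have hφ1 : ∀ n, ContDiff ℝ 1 (φ n) := fun n => (hφ n).of_le (by simp)
  have mono1 : (μH[1] : Measure Plane).restrict Γ ≤ μH[1].restrict (frontier A) :=
    Measure.restrict_mono hΓ le_rfl
  have mono2 : (μH[1] : Measure Plane).restrict (frontier A \ Γ) ≤ μH[1].restrict (frontier A) :=
    Measure.restrict_mono sdiff_subset le_rfl
  have lim1 := tendsto_eLpNorm_of_tendsto_sub one_le_two
    (fun n => (hφ n).continuous.aestronglyMeasurable) (hw.mono_measure mono1)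
    (tendsto_of_tendsto_of_tendsto_of_le_of_le tendsto_const_nhds hbd (fun _ => zero_le)
      fun n => eLpNorm_mono_measure _ mono1)
  have lim2 := tendsto_eLpNorm_of_tendsto_sub one_le_two
    (fun n => (hφ n).continuous.aestronglyMeasurable) (hw.mono_measure mono2)
    (tendsto_of_tendsto_of_tendsto_of_le_of_le tendsto_const_nhds hbd (fun _ => zero_le)
      fun n => eLpNorm_mono_measure _ mono2)
  have lim3 := tendsto_eLpNorm_of_tendsto_sub one_le_two
    (fun n => (continuous_gradient (hφ1 n)).aestronglyMeasurable) h.isH1.memLp_grad hgrad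
  have hw0 : eLpNorm w 2 ((μH[1] : Measure Plane).restrict (frontier A \ Γ)) = 0 := by
    rw [eLpNorm_congr_ae (g := fun _ => 0) h.vanishes]; simp
  rw [hw0] at lim2
  -- The trace hypothesis provides all three limits; the boundary term off Γ disappears.
  have hlim : eLpNorm w 2 ((μH[1] : Measure Plane).restrict Γ) ^ 2 ≤
      C * (0 ^ 2 + ENNReal.ofReal δ * eLpNorm g 2 (volume.restrict A) ^ 2) := by
    refine le_of_tendsto_of_tendsto' (ENNReal.Tendsto.pow lim1) (ENNReal.Tendsto.const_mul ((ENNReal.Tendsto.pow lim2).add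
      (ENNReal.Tendsto.const_mul (ENNReal.Tendsto.pow lim3) (.inr ENNReal.ofReal_ne_top)))
      (.inr ENNReal.coe_ne_top)) fun n => ?_
    simp only [eLpNorm_two_sq]
    exact hC _ (hφ1 n)
  have hsq : ∀ {E : Type} [NormedAddCommGroup E] {μ : Measure Plane} {f : Plane → E},
      MemLp f 2 μ → eLpNorm f 2 μ ^ 2 = ENNReal.ofReal (∫ x, ‖f x‖ ^ 2 ∂μ) := by
    intro E _ μ f hf
    rw [eLpNorm_two_sq, ofReal_integral_eq_lintegral_ofReal ((memLp_two_iff_integrable_sq_norm hf.1).1 hf)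
      (Eventually.of_forall fun x => by positivity)]
    simp [ENNReal.ofReal_pow]
  rw [hsq (hw.mono_measure mono1), hsq h.isH1.memLp_grad] at hlim
  simp only [Real.norm_eq_abs, sq_abs, h.normalized] at hlim
  rw [zero_pow two_ne_zero, zero_add, ← ENNReal.ofReal_mul hδ, ← ENNReal.ofReal_coe_nnreal,
    ← ENNReal.ofReal_mul (NNReal.coe_nonneg C), ENNReal.ofReal_le_ofReal_iff (by positivity)] at hlim
  rwa [mul_assoc]

end Energy

/-! ### Existence of competitors -/

section Competitor

open Measure NNReal ENNReal

theorem gradient_apply_eq_fderiv_single (φ : Plane → ℝ) (x : Plane) (i : Fin 2) :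
    gradient φ x i = fderiv ℝ φ x (EuclideanSpace.single i 1) := by
  rw [← inner_gradient_left, EuclideanSpace.inner_single_right]
  simp

/-- Test functions are supported in A, so the integrals extend to the whole plane, where integration
by parts has no boundary term. No regularity of A is needed. -/
theorem isH1With_of_hasCompactSupport (A : Set Plane) {φ : Plane → ℝ} (hφ : ContDiff ℝ ∞ φ)
    (hc : HasCompactSupport φ) : IsH1With A φ (gradient φ) := by
  have hφ1 : ContDiff ℝ 1 φ := hφ.of_le (by simp)
  have hgc : HasCompactSupport (gradient φ) :=
    (hc.fderiv ℝ).comp_left (g := (InnerProductSpace.toDual ℝ Plane).symm) (map_zero _)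
  refine ⟨(hφ.continuous.memLp_of_hasCompactSupport hc).restrict A,
    ((continuous_gradient hφ1).memLp_of_hasCompactSupport hgc).restrict A, ?_⟩
  intro ψ hψ hψc hψA i
  have hψ1 : ContDiff ℝ 1 ψ := hψ.of_le (by simp)
  have hψ0 : ∀ x ∉ A, ψ x = 0 := fun x hx => image_eq_zero_of_notMem_tsupport fun h => hx (hψA h)
  have hψ'0 : ∀ x ∉ A, fderiv ℝ ψ x = 0 := fun x hx =>
    image_eq_zero_of_notMem_tsupport fun h => hx (hψA (tsupport_fderiv_subset ℝ h))
  rw [setIntegral_eq_integral_of_forall_compl_eq_zero (fun x hx => by simp [hψ'0 x hx]),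
    setIntegral_eq_integral_of_forall_compl_eq_zero (fun x hx => by simp [hψ0 x hx])]
  simp_rw [gradient_apply_eq_fderiv_single]
  have hcφ' : Continuous fun x => fderiv ℝ φ x (EuclideanSpace.single i 1) :=
    (hφ1.continuous_fderiv one_ne_zero).clm_apply continuous_const
  have hcψ' : Continuous fun x => fderiv ℝ ψ x (EuclideanSpace.single i 1) :=
    (hψ1.continuous_fderiv one_ne_zero).clm_apply continuous_const
  exact integral_mul_fderiv_eq_neg_fderiv_mul_of_integrable
    ((hcφ'.mul hψ.continuous).integrable_of_hasCompactSupport hψc.mul_left)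
    ((hφ.continuous.mul hcψ').integrable_of_hasCompactSupport hc.mul_right)
    ((hφ.continuous.mul hψ.continuous).integrable_of_hasCompactSupport hc.mul_right)
    (fun x _ => hφ1.differentiable one_ne_zero x) (fun x _ => hψ1.differentiable one_ne_zero x)

/-- A bump at p, scaled to unit norm on Γ, is its own trace via a constant sequence; on the boundary
it is supported in Γ. -/
theorem exists_isCompetitor {Γ A : Set Plane} {p : Plane} {r : ℝ} (hr : 0 < r)
    (hΓm : MeasurableSet Γ) (hball : ∀ x ∈ frontier A, x ∈ Metric.ball p r → x ∈ Γ)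
    (hfin : μH[1] Γ ≠ ⊤) (hpos : 0 < μH[1] (Γ ∩ Metric.ball p (r / 2))) :
    ∃ v g w, IsCompetitor Γ A v g w := by
  let f : ContDiffBump p := ⟨r / 2, r, half_pos hr, half_lt_self hr⟩
  have : IsFiniteMeasure ((μH[1] : Measure Plane).restrict Γ) :=
    ⟨by rw [Measure.restrict_apply_univ]; exact hfin.lt_top⟩
  have hmem : MemLp f 2 ((μH[1] : Measure Plane).restrict Γ) :=
    MemLp.of_bound f.continuous.aestronglyMeasurable 1 (Eventually.of_forall fun x => by
      rw [Real.norm_eq_abs, abs_of_nonneg f.nonneg]; exact f.le_one)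
  have hint : Integrable (fun x => f x ^ 2) ((μH[1] : Measure Plane).restrict Γ) :=
    hmem.integrable_sq
  set I := ∫ x in Γ, f x ^ 2 ∂μH[1] with hI
  have hIpos : 0 < I := by
    rw [hI, integral_pos_iff_support_of_nonneg (fun x => sq_nonneg (f x)) hint,
      Measure.restrict_apply' hΓm]
    refine hpos.trans_le (measure_mono fun x hx => ⟨?_, hx.1⟩)
    rw [Function.mem_support, f.one_of_mem_closedBall (Metric.ball_subset_closedBall hx.2)]
    norm_num
  set φ : Plane → ℝ := fun x => (√I)⁻¹ * f x with hφdef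
  have hφ : ContDiff ℝ ∞ φ := contDiff_const.mul f.contDiff
  have hzero : ∀ x ∈ frontier A \ Γ, φ x = 0 := fun x hx => by
    have : f x = 0 := f.zero_of_le_dist (not_lt.1 fun h => hx.2 (hball x hx.1 h))
    rw [hφdef]; simp [this]
  refine ⟨φ, gradient φ, φ, isH1With_of_hasCompactSupport A hφ f.hasCompactSupport.mul_left,
    ⟨?_, fun _ => φ, fun _ => hφ, by simp, by simp, by simp⟩, ?_, ?_⟩
  · have hfr : MeasurableSet (frontier A) := isClosed_frontier.measurableSet
    -- Only Γ is known to have finite length, not the whole frontier, so integrability is checked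
    -- after cutting off to Γ.
    have h1 : MemLp (Γ.indicator φ) 2 ((μH[1] : Measure Plane).restrict (frontier A)) := by
      rw [memLp_indicator_iff_restrict hΓm, Measure.restrict_restrict hΓm]
      exact (hmem.const_mul (√I)⁻¹).mono_measure (Measure.restrict_mono inter_subset_left le_rfl)
    refine h1.ae_eq ((ae_restrict_mem hfr).mono fun x hx => ?_)
    by_cases hxΓ : x ∈ Γ
    · simp [hxΓ]
    · simp [hxΓ, hzero x ⟨hx, hxΓ⟩]
  · simp only [hφdef, mul_pow]
    rw [integral_const_mul, ← hI, inv_pow, Real.sq_sqrt hIpos.le, inv_mul_cancel₀ hIpos.ne']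
  · exact (ae_restrict_mem (isClosed_frontier.measurableSet.diff hΓm)).mono hzero

/-- The admissible class is nonempty on either side of the arc. -/
theorem IsSimpleRegularArc.exists_isCompetitor {γ : ℝ → Plane} {a b c d δ : ℝ}
    (h : IsSimpleRegularArc γ c d) (hlt : a < b) (hab : Icc a b ⊆ Icc c d) (hδ : 0 < δ)
    {V W : Set Plane} (hV : IsOpen V) (hW : IsOpen W) (hd : Disjoint V W)
    (heq : Metric.thickening δ (γ '' Icc a b) \ γ '' Icc c d = V ∪ W) :
    ∃ v g w, IsCompetitor (γ '' Icc a b) V v g w := by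
  set m := (a + b) / 2 with hm
  have hmI : m ∈ Ioo a b := ⟨by linarith, by linarith⟩
  have hmI' : m ∈ Icc a b := Ioo_subset_Icc_self hmI
  -- Within ρ of the midpoint of Γ the extended arc has only parameters in [a, b].
  obtain ⟨ρ, hρ, hsep⟩ := h.exists_dist_lt (half_pos (sub_pos.2 hlt))
  have hr : 0 < min δ ρ := lt_min hδ hρ
  have hγc : ContinuousOn γ (Icc a b) := h.contDiffOn.continuousOn.mono hab
  have hΓc : IsCompact (γ '' Icc a b) := isCompact_Icc.image_of_continuousOn hγc
  obtain ⟨L, hL⟩ := h.contDiffOn.exists_lipschitzOnWith one_ne_zero (convex_Icc c d) isCompact_Icc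
  obtain ⟨k, hk, hkγ⟩ := h.exists_mul_abs_sub_le
  refine _root_.exists_isCompetitor (p := γ m) hr hΓc.measurableSet ?_ ?_ ?_
  · intro x hx hxb
    by_cases hxΓ : x ∈ γ '' Icc c d
    · obtain ⟨s, hs, rfl⟩ := hxΓ
      rw [Metric.mem_ball, dist_eq_norm] at hxb
      have := abs_lt.1 (hsep s hs m (hab hmI') (hxb.trans_le (min_le_right _ _)))
      exact mem_image_of_mem _ ⟨by linarith, by linarith⟩
    · have hxV : x ∈ V ∪ W := by
        rw [← heq]
        exact ⟨Metric.ball_subset_thickening (mem_image_of_mem _ hmI') δ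
          (Metric.ball_subset_ball (min_le_left _ _) hxb), hxΓ⟩
      rw [hV.frontier_eq] at hx
      rcases hxV with h1 | h1
      · exact (hx.2 h1).elim
      -- W is open and disjoint from V, so it misses the closure of V.
      · exact (disjoint_left.1 (hd.closure_left hW) hx.1 h1).elim
  · refine ne_top_of_le_ne_top ?_ ((hL.mono hab).hausdorffMeasure_image_le zero_le_one)
    rw [hausdorffMeasure_real, Real.volume_Icc]
    exact ENNReal.mul_ne_top (by simp) ENNReal.ofReal_ne_top
  · set B := Metric.ball (γ m) (min δ ρ / 2)
    have hopen : IsOpen (Ioo a b ∩ γ ⁻¹' B) :=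
      (hγc.mono Ioo_subset_Icc_self).isOpen_inter_preimage isOpen_Ioo Metric.isOpen_ball
    have hvol : 0 < volume (Ioo a b ∩ γ ⁻¹' B) :=
      hopen.measure_pos _ ⟨m, hmI, Metric.mem_ball_self (half_pos hr)⟩
    have hle := hausdorffMeasure_le_image_of_edist_le (f := γ) (s := Ioo a b ∩ γ ⁻¹' B)
      (K := k⁻¹.toNNReal) (fun x hx y hy => by
        rw [edist_dist, edist_dist, ← ENNReal.ofReal_coe_nnreal,
          ← ENNReal.ofReal_mul (NNReal.coe_nonneg _)]
        refine ENNReal.ofReal_le_ofReal ?_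
        rw [Real.coe_toNNReal _ (inv_pos.2 hk).le, Real.dist_eq, dist_eq_norm, inv_mul_eq_div,
          le_div_iff₀ hk, mul_comm]
        exact hkγ x (hab (Ioo_subset_Icc_self hx.1)) y (hab (Ioo_subset_Icc_self hy.1)))
      zero_le_one
    rw [hausdorffMeasure_real] at hle
    have hsub : γ '' (Ioo a b ∩ γ ⁻¹' B) ⊆ γ '' Icc a b ∩ B := by
      rintro _ ⟨s, hs, rfl⟩
      exact ⟨mem_image_of_mem _ (Ioo_subset_Icc_self hs.1), hs.2⟩
    by_contra hcon
    rw [not_lt, nonpos_iff_eq_zero] at hcon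
    rw [measure_mono_null hsub hcon, mul_zero] at hle
    exact hvol.not_ge hle

/-! ### Lower bound of order 1/δ and conclusion -/

/-- The energy of a competitor on a strip of width `δ` is at least of order `δ⁻¹`. -/
theorem IsTubularField.exists_inv_le_energy {γ T N : ℝ → Plane} {a b c d k δ₀ ρ : ℝ} {M : ℝ≥0}
    (hN : IsTubularField γ N a b k δ₀) (hγ : LipschitzOnWith M γ (Icc a b))
    (hF : IsTransverseFrame γ T N c d ρ) (hab : Icc a b ⊆ Icc c d) :
    ∃ C : ℝ, 0 < C ∧ ∀ δ ∈ Ioc 0 δ₀, δ < ρ / 4 → ∀ v g w,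
      IsCompetitor (γ '' Icc a b) (sideStrip γ N a b c d ρ δ) v g w →
      C * δ⁻¹ ≤ ∫ x in sideStrip γ N a b c d ρ δ, ‖g x‖ ^ 2 := by
  obtain ⟨C, hC⟩ := hN.exists_setLIntegral_enorm_sq_le hγ
  -- Adding 1 keeps the constant positive even if C = 0.
  refine ⟨((C : ℝ) + 1)⁻¹, by positivity, fun δ hδ hδρ v g w hv => ?_⟩
  set A := sideStrip γ N a b c d ρ δ with hA
  have hin : ∀ s ∈ Icc a b, ∀ t ∈ Ioo 0 δ, γ s + t • N s ∈ A := fun s hs t ht =>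
    hF.add_smul_mem_sideStrip hab hδρ hs ht
  -- The tubular bound puts the end of each normal segment at distance at least δ from Γ, hence
  -- outside the open strip.
  have hout : ∀ s ∈ Icc a b, γ s + δ • N s ∉ Metric.thickening δ (γ '' Icc a b) := by
    intro s hs hmem
    rw [Metric.mem_thickening_iff] at hmem
    obtain ⟨_, ⟨s', hs', rfl⟩, hlt⟩ := hmem
    rw [dist_eq_norm] at hlt
    exact (hN.le_norm s hs s' hs' δ ⟨hδ.1.le, hδ.2⟩).not_gt hlt
  have hfr : ∀ s ∈ Icc a b, γ s + δ • N s ∈ frontier A \ γ '' Icc a b := by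
    intro s hs
    refine ⟨?_, fun hmem => hout s hs (Metric.self_subset_thickening hδ.1 _ hmem)⟩
    rw [(isOpen_sideStrip _ _ _ _ _ _ _ _).frontier_eq]
    refine ⟨?_, fun hmem => hout s hs hmem.1⟩
    have hlim : Tendsto (fun t : ℝ => γ s + t • N s) (𝓝[<] δ) (𝓝 (γ s + δ • N s)) := by
      have : Continuous fun t : ℝ => γ s + t • N s := by fun_prop
      exact (this.tendsto δ).mono_left nhdsWithin_le_nhds
    refine mem_closure_of_tendsto hlim ?_
    filter_upwards [Ioo_mem_nhdsLT hδ.1] with t ht using hin s hs t ht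
  have h1 := hv.one_le_mul_energy (hF.image_subset_frontier_sideStrip hab hδ.1 hδρ) hδ.1.le
    (hC δ hδ A _ hin hfr)
  have h2 : 0 ≤ ∫ x in A, ‖g x‖ ^ 2 := integral_nonneg fun x => by positivity
  have h3 : 0 ≤ δ * ∫ x in A, ‖g x‖ ^ 2 := mul_nonneg hδ.1.le h2
  rw [← mul_inv, inv_le_iff_one_le_mul₀ (mul_pos (by positivity) hδ.1)]
  nlinarith

end Competitor

/-- `K(Γ, A)` tends to infinity along one side of the arc. -/
theorem exists_inv_le_capacityK {γ T N : ℝ → Plane} {a b c d k δ₀ δ₁ ρ : ℝ}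
    (h : IsSimpleRegularArc γ c d) (hlt : a < b) (hab : Icc a b ⊆ Icc c d)
    (hN : IsTubularField γ N a b k δ₀) (hF : IsTransverseFrame γ T N c d ρ) (hδ₁ : δ₁ < ρ / 4)
    (heq : ∀ δ ∈ Ioo 0 δ₁, Metric.thickening δ (γ '' Icc a b) \ γ '' Icc c d =
      sideStrip γ N a b c d ρ δ ∪ sideStrip γ (-N) a b c d ρ δ) :
    ∃ C : ℝ, 0 < C ∧ ∀ δ ∈ Ioo 0 (min δ₀ δ₁),
      C * δ⁻¹ ≤ capacityK (γ '' Icc a b) (sideStrip γ N a b c d ρ δ) := by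
  obtain ⟨M, hM⟩ := h.contDiffOn.exists_lipschitzOnWith one_ne_zero (convex_Icc c d) isCompact_Icc
  obtain ⟨C, hC, hle⟩ := hN.exists_inv_le_energy (hM.mono hab) hF hab
  refine ⟨C, hC, fun δ hδ => ?_⟩
  have hδ0 : δ < δ₀ := hδ.2.trans_le (min_le_left _ _)
  have hδ1 : δ < δ₁ := hδ.2.trans_le (min_le_right _ _)
  -- Nonemptiness is essential: `sInf ∅ = 0` would violate the bound.
  refine le_csInf ?_ ?_
  · obtain ⟨v, g, w, hv⟩ := h.exists_isCompetitor hlt hab hδ.1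
      (isOpen_sideStrip γ N a b c d ρ δ) (isOpen_sideStrip γ (-N) a b c d ρ δ)
      hF.disjoint_sideStrip (heq δ ⟨hδ.1, hδ1⟩)
    exact ⟨_, v, g, w, hv, rfl⟩
  · rintro _ ⟨v, g, w, hv, rfl⟩
    exact hle δ ⟨hδ.1, hδ0.le⟩ (hδ1.trans hδ₁) v g w hv

/-- The selection `A` is arbitrary for each δ, which covers every labelling. As `sInf ∅ = 0`,
divergence to +∞ also forces competitors to exist for small δ. -/
theorem mainTheorem8 (γ : ℝ → Plane) (a b c d : ℝ) (hca : c < a) (hbd : b < d)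
    (hΓ : IsSimpleAnalyticArc γ a b) (hΓext : IsSimpleRegularArc γ c d) :
    (∀ᶠ δ in 𝓝[>] (0 : ℝ),
      (componentsOf (Metric.thickening δ (γ '' Icc a b) \ γ '' Icc c d)).ncard = 2 ∧
      ∀ C ∈ componentsOf (Metric.thickening δ (γ '' Icc a b) \ γ '' Icc c d),
        γ '' Icc a b ⊆ frontier C) ∧
    ∀ A : ℝ → Set Plane,
      (∀ᶠ δ in 𝓝[>] (0 : ℝ),
        A δ ∈ componentsOf (Metric.thickening δ (γ '' Icc a b) \ γ '' Icc c d)) →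
      Tendsto (fun δ => capacityK (γ '' Icc a b) (A δ)) (𝓝[>] (0 : ℝ)) atTop := by
  have hab : Icc a b ⊆ Icc c d := Icc_subset_Icc hca.le hbd.le
  obtain ⟨ρ, hF⟩ := hΓext.exists_isTransverseFrame
  obtain ⟨δ₁, hδ₁, hδρ, hside⟩ := hΓext.exists_thickening_diff_eq hca hΓ.lt hbd hF
  have hcomp : ∀ δ ∈ Ioo 0 δ₁,
      componentsOf (Metric.thickening δ (γ '' Icc a b) \ γ '' Icc c d) =
        {sideStrip γ (unitNormal γ c d) a b c d ρ δ,
          sideStrip γ (-unitNormal γ c d) a b c d ρ δ} := fun δ hδ => by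
    obtain ⟨heq, h1, h2⟩ := hside δ hδ
    exact componentsOf_eq_pair heq (isOpen_sideStrip _ _ _ _ _ _ _ _)
      (isOpen_sideStrip _ _ _ _ _ _ _ _) hF.disjoint_sideStrip h1 h2
  constructor
  · filter_upwards [Ioo_mem_nhdsGT hδ₁] with δ hδ
    rw [hcomp δ hδ]
    refine ⟨ncard_pair fun heq => ?_, ?_⟩
    · have hd := hF.disjoint_sideStrip (a := a) (b := b) (δ := δ)
      rw [← heq, disjoint_self] at hd
      exact (hside δ hδ).2.1.nonempty.ne_empty hd
    · rintro C (rfl | rfl)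
      · exact hF.image_subset_frontier_sideStrip hab hδ.1 (hδ.2.trans hδρ)
      · exact hF.neg.image_subset_frontier_sideStrip hab hδ.1 (hδ.2.trans hδρ)
  · intro A hA
    obtain ⟨⟨k, δ₂, hδ₂, hT⟩, ⟨k', δ₃, hδ₃, hT'⟩⟩ := hΓ.exists_isTubularField hΓext hab
    obtain ⟨C, hC, hle⟩ := exists_inv_le_capacityK hΓext hΓ.lt hab hT hF hδρ
      fun δ hδ => (hside δ hδ).1
    obtain ⟨C', hC', hle'⟩ := exists_inv_le_capacityK hΓext hΓ.lt hab hT' hF.neg hδρ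
      fun δ hδ => by rw [neg_neg, union_comm]; exact (hside δ hδ).1
    -- The selected side may switch with δ, so the smaller of the two constants is used.
    refine tendsto_atTop_mono' _ ?_ (tendsto_inv_nhdsGT_zero.const_mul_atTop (lt_min hC hC'))
    filter_upwards [hA, Ioo_mem_nhdsGT hδ₁, Ioo_mem_nhdsGT hδ₂, Ioo_mem_nhdsGT hδ₃]
      with δ hAδ h1 h2 h3
    have hinv : 0 ≤ δ⁻¹ := inv_nonneg.2 h1.1.le
    rw [hcomp δ h1] at hAδ
    rcases hAδ with heq | heq
    · rw [heq]
      exact (mul_le_mul_of_nonneg_right (min_le_left _ _) hinv).trans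
        (hle δ ⟨h1.1, lt_min h2.2 h1.2⟩)
    · rw [heq]
      exact (mul_le_mul_of_nonneg_right (min_le_right _ _) hinv).trans
        (hle' δ ⟨h1.1, lt_min h3.2 h1.2⟩)
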